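/- Theorem 1. Let $\vartheta_0\in[0,\pi/2]$ be the unique number with $\pi-\vartheta_0=\cot(\vartheta_0/2)$. For $a>0$, $b\in(0,a/2)$ and $q>0$ put $F(t)=a\sin t+2b$, and let $t_2<t_3$ be the two zeros of $F$ in $[0,2\pi]$. The dry-friction oscillator consists of a mass at position $x$ and a delimiter at position $y\ge x$ that never moves back; $x$, $\dot x$, $y$ are continuous, and every bounded time interval is split into finitely many pieces on which one of three regimes holds: free motion ($x<y$, $\ddot x=F(t)$, $\dot y=0$); contact with progression ($x=y$, $\dot x>0$, $\ddot x=F(t)-q$); stop ($x=y$, $\dot x=\dot y=0$, where $0\le F(t)\le q$). A transition to free motion is an instant at which $x=y$ and $\dot x=0$ and immediately after which $x<y$ (grazing contacts included). For all $a>0$ and $q\in(a\sin\vartheta_0,a)$ there is $b_0=b_0(a,q)\in(0,a/2]$ such that for every $b\in(0,b_0)$ the following holds. Every transition to free motion has its phase (time modulo $2\pi$) in $[t_2,t_3)$; every phase in $[t_2,t_3)$ is the phase of such a transition, a next transition to free motion exists and is uniquely determined, and its phase depends only on the phase of the given transition. This defines a map $T:[t_2,t_3)\to[t_2,t_3)$,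 which is discontinuous. There are two disjoint non-degenerate closed segments $J_0,J_1\subset[t_2,3\pi/2]$ such that $T$ is continuous on each $J_i$ and $T(J_i)\supset[t_2,3\pi/2]$. There is an infinite set $P$ of periodic points of $T$ whose minimal periods are unbounded. Moreover, there is a compact set $J\subset J_0\cup J_1$ with $T(J)=J$ such that $T|_J$ is continuous and is semi-conjugate, by a continuous surjection $H:J\to\{0,1\}^{\mathbb N}$ with $H\circ T=S\circ H$, to the one-sided shift $S$ on $\{0,1\}^{\mathbb N}$. -/

import Mathlib

open Set Filter Topology

/-- The external force `F(t) = a sin t + 2b`. -/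
noncomputable def force (a b t : ℝ) : ℝ := a * Real.sin t + 2 * b

/-- The phase `t mod 2π`, represented in `[0, 2π)`. -/
noncomputable def phase (t : ℝ) : ℝ := toIcoMod Real.two_pi_pos 0 t

/-- The smaller zero of the force in `[0, 2π]`. -/
noncomputable def phase2 (a b : ℝ) : ℝ := Real.pi + Real.arcsin (2 * b / a)

/-- The larger zero of the force in `[0, 2π]`. -/
noncomputable def phase3 (a b : ℝ) : ℝ := 2 * Real.pi - Real.arcsin (2 * b / a)

/-- For `0 < b < a / 2`, the numbers `phase2 a b < phase3 a b` are exactly the zeros of the force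
on `[0, 2π]`. -/
theorem phase2_phase3_spec (a b : ℝ) (ha : 0 < a) (hb : 0 < b) (hba : b < a / 2) :
    phase2 a b < phase3 a b ∧
      {t | t ∈ Icc 0 (2 * Real.pi) ∧ force a b t = 0} = {phase2 a b, phase3 a b} := by
  have hc0 : 0 < 2 * b / a := by positivity
  have hc1 : 2 * b / a < 1 := by rw [div_lt_one ha]; linarith
  have hA0 : 0 < Real.arcsin (2 * b / a) := Real.arcsin_pos.2 hc0
  have hA1 : Real.arcsin (2 * b / a) < Real.pi / 2 := Real.arcsin_lt_pi_div_two.2 hc1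
  have hs : Real.sin (Real.arcsin (2 * b / a)) = 2 * b / a :=
    Real.sin_arcsin (by linarith) hc1.le
  have hab : a * (2 * b / a) = 2 * b := by field_simp
  refine ⟨by unfold phase2 phase3; linarith, ?_⟩
  ext t
  simp only [mem_ofPred_eq, mem_insert_iff, mem_singleton_iff, mem_Icc, force, phase2, phase3]
  constructor
  · rintro ⟨⟨h0, h1⟩, hF⟩
    have hsin : Real.sin t = -(2 * b / a) := by
      field_simp
      linarith
    have hpi : Real.pi < t := by
      by_contra h
      have := Real.sin_nonneg_of_nonneg_of_le_pi h0 (not_lt.1 h)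
      linarith
    rcases le_total t (3 * Real.pi / 2) with h | h
    · left
      have h2 : Real.sin (t - Real.pi) = 2 * b / a := by rw [Real.sin_sub_pi]; linarith
      rw [← h2, Real.arcsin_sin (by linarith) (by linarith)]
      ring
    · right
      have h2 : Real.sin (2 * Real.pi - t) = 2 * b / a := by
        rw [Real.sin_two_pi_sub]; linarith
      rw [← h2, Real.arcsin_sin (by linarith) (by linarith)]
      ring
  · rintro (rfl | rfl)
    · refine ⟨⟨by linarith, by linarith⟩, ?_⟩
      rw [add_comm Real.pi, Real.sin_add_pi, hs]
      linarith
    · refine ⟨⟨by linarith, by linarith⟩, ?_⟩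
      rw [Real.sin_two_pi_sub, hs]
      linarith

/-- Free motion on the open time interval `(r, s)`: no contact, `x'' = F(t)`, `y' = 0`.
Here `x` is the position of the mass, `v` its velocity, `y` the position of the delimiter. -/
def FreeOn (a b : ℝ) (x v y : ℝ → ℝ) (r s : ℝ) : Prop :=
  ∀ t ∈ Ioo r s, x t < y t ∧ HasDerivAt v (force a b t) t ∧ HasDerivAt y 0 t

/-- Contact with progression on `(r, s)`: the mass pushes the delimiter forward,
`y = x` and `x'' = F(t) - q`. -/
def ProgressionOn (a b q : ℝ) (x v y : ℝ → ℝ) (r s : ℝ) : Prop :=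
  ∀ t ∈ Ioo r s, x t = y t ∧ 0 < v t ∧ HasDerivAt v (force a b t - q) t

/-- Stop on `(r, s)`: mass and delimiter are in contact and at rest; the friction, of magnitude
at most `q` and opposed to forward motion, balances the external force. -/
def StopOn (a b q : ℝ) (x v y : ℝ → ℝ) (r s : ℝ) : Prop :=
  ∀ t ∈ Ioo r s, x t = y t ∧ v t = 0 ∧ HasDerivAt y 0 t ∧ 0 ≤ force a b t ∧ force a b t ≤ q

/-- `(x, v, y)` is a motion of the dry-friction oscillator on the time interval `[s, e]`:
position, velocity and delimiter are continuous, the mass does not penetrate the delimiter, the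
delimiter does not move back, and `[s, e]` splits into finitely many pieces with a single regime
on each open piece. -/
structure IsMotion (a b q s e : ℝ) (x v y : ℝ → ℝ) : Prop where
  continuousOn_x : ContinuousOn x (Icc s e)
  continuousOn_v : ContinuousOn v (Icc s e)
  continuousOn_y : ContinuousOn y (Icc s e)
  hasDerivAt_x : ∀ t ∈ Ioo s e, HasDerivAt x (v t) t
  le : ∀ t ∈ Icc s e, x t ≤ y t
  monotoneOn_y : MonotoneOn y (Icc s e)
  regimes : ∃ (n : ℕ) (τ : ℕ → ℝ), τ 0 = s ∧ τ n = e ∧ ∀ i < n, τ i < τ (i + 1) ∧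
    (FreeOn a b x v y (τ i) (τ (i + 1)) ∨ ProgressionOn a b q x v y (τ i) (τ (i + 1)) ∨
      StopOn a b q x v y (τ i) (τ (i + 1)))

/-- At time `t` there is a transition to free motion: an (instantaneous) stop at the delimiter
followed immediately by motion without contact. Grazing contacts are included. -/
def ToFree (x v y : ℝ → ℝ) (t : ℝ) : Prop :=
  x t = y t ∧ v t = 0 ∧ ∀ᶠ u in 𝓝[>] t, x u < y u

/-- `τ` is the first transition to free motion after time `s`. -/
def IsFirstToFreeAfter (x v y : ℝ → ℝ) (s τ : ℝ) : Prop :=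
  s < τ ∧ ToFree x v y τ ∧ ∀ u ∈ Ioo s τ, ¬ ToFree x v y u

/-- `T` is the switching-phase map: transitions to free motion occur only at phases in `[t₂, t₃)`;
from every time `s` with such a phase a motion starts with a transition to free motion, and the
time `τ` of the next transition is the same for all such motions that last beyond `τ`;
the phase of `τ` is the value of `T` at the phase of `s`. -/
def IsSwitchingPhaseMap (a b q : ℝ) (T : ℝ → ℝ) : Prop :=
  (∀ (s e : ℝ) (x v y : ℝ → ℝ), s < e → IsMotion a b q s e x v y → ToFree x v y s →
      phase s ∈ Ico (phase2 a b) (phase3 a b)) ∧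
  ∀ s : ℝ, phase s ∈ Ico (phase2 a b) (phase3 a b) →
    ∃ τ : ℝ,
      (∃ (e : ℝ) (x v y : ℝ → ℝ), τ < e ∧ IsMotion a b q s e x v y ∧ ToFree x v y s ∧
        IsFirstToFreeAfter x v y s τ) ∧
      (∀ (e : ℝ) (x v y : ℝ → ℝ), τ < e → IsMotion a b q s e x v y → ToFree x v y s →
        IsFirstToFreeAfter x v y s τ) ∧
      T (phase s) = phase τ

/-! Write β = `zeroAngle a b`, γ = `slipPhase a b q` and ϑ = arcsin (q / a); as b → 0, β → 0 and γ →
ϑ. A free motion from rest at s has displacement (t - s)(a cos s + b (t - s)) up to a bounded term,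
so for small b and s near π it lasts about a/b, many periods of the force, and a small change of s
sweeps the return time θ through whole periods. Near such a return the velocity is a (1 - cos t) +
O(b), independently of s (`freeVel_abs_le`). In the contact that follows, the mass halts when a (1 -
cos t) ≈ q (t - θ).

A halt at a phase in [π + β, 2π - β) starts the next free motion. After any other halt the mass
stays in contact until π + β, possibly slipping from γ on; the slip ends before π + β
(`exists_slip`). Hence the next phase is max(u, π + β), where u is the halt phase in [-β, 2π - β).

The key is a return phase α such that a return at α halts before π + β, in the limit 2 < (π - α) sin
ϑ, while returns at phases from α to 3π/2 are still moving when the velocity has its minimum at γ,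
in the limit (ϑ - α) sin ϑ < 1 - cos ϑ. Such α exists exactly when 1 + cos ϑ < (π - ϑ) sin ϑ, which
is also the limit of the slip condition. By monotonicity it holds for ϑ > ϑ₀, that is, for q > a sin
ϑ₀ (`lt_pi_sub_mul_sin`). As the return phase runs from α to 3π/2 within one period, the halt moves
continuously from before π + β to beyond 3π/2, so the corresponding segment of starts covers [π + β,
3π/2] (`exists_branch`). Two consecutive periods give a horseshoe, and the passage between them a
discontinuity. Periodic points and the shift follow by pulling segments back along words
(`Horseshoe.exists_segment`).

The dynamics is treated from two sides: continuous induction forces every motion onto this course,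
and gluing explicit pieces shows that such a motion exists. -/

/-! ### Explicit solutions -/

/-- Velocity at time `t` of a free motion that starts from rest at time `s`. -/
noncomputable def freeVel (a b s t : ℝ) : ℝ :=
  a * (Real.cos s - Real.cos t) + 2 * b * (t - s)

/-- Displacement at time `t` of a free motion that starts from rest at time `s`. -/
noncomputable def freeDisp (a b s t : ℝ) : ℝ :=
  a * (Real.sin s - Real.sin t + (t - s) * Real.cos s) + b * (t - s) ^ 2

theorem hasDerivAt_freeVel (a b s t : ℝ) :
    HasDerivAt (freeVel a b s) (force a b t) t := by
  have h1 := (((Real.hasDerivAt_cos t).const_sub (Real.cos s)).const_mul a).add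
    (((hasDerivAt_id t).sub_const s).const_mul (2 * b))
  refine h1.congr_deriv ?_
  simp [force]

theorem hasDerivAt_freeDisp (a b s t : ℝ) :
    HasDerivAt (freeDisp a b s) (freeVel a b s t) t := by
  have h1 := ((((Real.hasDerivAt_sin t).const_sub (Real.sin s)).add
    (((hasDerivAt_id t).sub_const s).mul_const (Real.cos s))).const_mul a).add
    ((((hasDerivAt_id t).sub_const s).pow 2).const_mul b)
  refine h1.congr_deriv ?_
  simp [freeVel]
  ring

theorem continuous_freeVel (a b s : ℝ) : Continuous (freeVel a b s) := by
  unfold freeVel; fun_prop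

theorem continuous_freeDisp (a b s : ℝ) : Continuous (freeDisp a b s) := by
  unfold freeDisp; fun_prop

theorem continuous_force (a b : ℝ) : Continuous (force a b) := by
  unfold force; fun_prop

@[simp] theorem freeVel_self (a b s : ℝ) : freeVel a b s s = 0 := by simp [freeVel]

@[simp] theorem freeDisp_self (a b s : ℝ) : freeDisp a b s s = 0 := by simp [freeDisp]

theorem freeVel_add (a b r s t : ℝ) : freeVel a b r s + freeVel a b s t = freeVel a b r t := by
  unfold freeVel; ring

/-! ### Calculus helpers -/

theorem eq_of_hasDerivAt_zero {f : ℝ → ℝ} {r u : ℝ} (h : r ≤ u) (hc : ContinuousOn f (Icc r u))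
    (hd : ∀ t ∈ Ioo r u, HasDerivAt f 0 t) : f u = f r := by
  rcases h.eq_or_lt with rfl | h
  · rfl
  obtain ⟨c, -, hc⟩ := exists_hasDerivAt_eq_slope f (fun _ => 0) h hc hd
  have : u - r ≠ 0 := by linarith
  field_simp at hc
  linarith

/-- Continuous induction: the set of agreement is closed, and each of its points pushes agreement to
the right. It follows a motion knowing only which regime starts at each single time. -/
theorem eqOn_Icc_of_forall_eventually {E : Type*} [TopologicalSpace E] [T2Space E] {f g : ℝ → E}
    {r m : ℝ} (hf : ContinuousOn f (Icc r m)) (hg : ContinuousOn g (Icc r m)) (hr : f r = g r)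
    (h : ∀ t ∈ Ico r m, f t = g t → ∀ᶠ u in 𝓝[>] t, f u = g u) : EqOn f g (Icc r m) := by
  have hcl : IsClosed ({t | f t = g t} ∩ Icc r m) := by
    have := (hf.prodMk hg).preimage_isClosed_of_isClosed isClosed_Icc (isClosed_diagonal (X := E))
    rw [inter_comm]
    exact this
  exact hcl.Icc_subset_of_forall_mem_nhdsWithin hr fun t ht => h t ht.2 ht.1

theorem lt_of_hasDerivAt_pos {f f' : ℝ → ℝ} {r u : ℝ} (h : r < u) (hc : ContinuousOn f (Icc r u))
    (hd : ∀ t ∈ Ioo r u, HasDerivAt f (f' t) t) (hp : ∀ t ∈ Ioo r u, 0 < f' t) : f r < f u := by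
  obtain ⟨c, hc, he⟩ := exists_hasDerivAt_eq_slope f f' h hc hd
  have h1 := hp c hc
  rw [he] at h1
  have h2 : 0 < u - r := by linarith
  have := (div_pos_iff_of_pos_right h2).1 h1
  linarith

/-! ### Local behaviour of a motion -/

section Motion

variable {a b q s e : ℝ} {x v y : ℝ → ℝ}

theorem FreeOn.mono {r u r' u' : ℝ} (h : FreeOn a b x v y r u) (hr : r ≤ r') (hu : u' ≤ u) :
    FreeOn a b x v y r' u' := fun t ht => h t ⟨by linarith [ht.1], by linarith [ht.2]⟩

theorem ProgressionOn.mono {r u r' u' : ℝ} (h : ProgressionOn a b q x v y r u) (hr : r ≤ r')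
    (hu : u' ≤ u) :
    ProgressionOn a b q x v y r' u' := fun t ht => h t ⟨by linarith [ht.1], by linarith [ht.2]⟩

theorem StopOn.mono {r u r' u' : ℝ} (h : StopOn a b q x v y r u) (hr : r ≤ r') (hu : u' ≤ u) :
    StopOn a b q x v y r' u' := fun t ht => h t ⟨by linarith [ht.1], by linarith [ht.2]⟩

/-- The uniqueness arguments use the finite partition only in this local form. -/
theorem IsMotion.exists_regime (h : IsMotion a b q s e x v y) {t : ℝ} (ht : t ∈ Ico s e) :
    ∃ t' ∈ Ioc t e, FreeOn a b x v y t t' ∨ ProgressionOn a b q x v y t t' ∨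
      StopOn a b q x v y t t' := by
  obtain ⟨n, τ, h0, hn, hτ⟩ := h.regimes
  have hle : ∀ j ≤ n, τ j ≤ e := by
    intro j hj
    induction hj using Nat.decreasingInduction with
    | self => exact hn.le
    | of_succ k hk ih => exact (hτ k hk).1.le.trans ih
  have key : ∀ j ≤ n, t < τ j → ∃ t' ∈ Ioc t e, FreeOn a b x v y t t' ∨
      ProgressionOn a b q x v y t t' ∨ StopOn a b q x v y t t' := by
    intro j
    induction j with
    | zero => intro _ h; rw [h0] at h; exact absurd ht.1 (not_le.2 h)
    | succ j ih =>
      intro hj htj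
      by_cases hlt : t < τ j
      · exact ih (by omega) hlt
      · push Not at hlt
        refine ⟨τ (j + 1), ⟨htj, hle _ hj⟩, ?_⟩
        rcases (hτ j (by omega)).2 with h | h | h
        · exact Or.inl (h.mono hlt le_rfl)
        · exact Or.inr (Or.inl (h.mono hlt le_rfl))
        · exact Or.inr (Or.inr (h.mono hlt le_rfl))
  exact key n le_rfl (hn ▸ ht.2)

theorem IsMotion.eq_of_freeOn (h : IsMotion a b q s e x v y) {t t' : ℝ} (hst : s ≤ t)
    (hte : t' ≤ e) (hf : FreeOn a b x v y t t') {u : ℝ} (hu : u ∈ Icc t t') :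
    v u = v t + freeVel a b t u ∧ x u = x t + v t * (u - t) + freeDisp a b t u ∧ y u = y t := by
  have hsub : ∀ {u}, u ∈ Icc t t' → Icc t u ⊆ Icc s e := fun hu =>
    Icc_subset_Icc hst (hu.2.trans hte)
  have hv : ∀ u ∈ Icc t t', v u = v t + freeVel a b t u := by
    intro u hu
    have := eq_of_hasDerivAt_zero (f := fun u => v u - freeVel a b t u) hu.1
      ((h.continuousOn_v.mono (hsub hu)).sub (continuous_freeVel a b t).continuousOn)
      (fun r hr => ((hf r ⟨hr.1, hr.2.trans_le hu.2⟩).2.1.sub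
        (hasDerivAt_freeVel a b t r)).congr_deriv (sub_self _))
    simp at this
    linarith
  refine ⟨hv u hu, ?_, eq_of_hasDerivAt_zero hu.1 (h.continuousOn_y.mono (hsub hu))
    fun r hr => (hf r ⟨hr.1, hr.2.trans_le hu.2⟩).2.2⟩
  have := eq_of_hasDerivAt_zero (f := fun u => x u - (v t * (u - t) + freeDisp a b t u)) hu.1
    ((h.continuousOn_x.mono (hsub hu)).sub (Continuous.continuousOn (by
      have := continuous_freeDisp a b t
      fun_prop)))
    (fun r hr => by
      refine ((h.hasDerivAt_x r ⟨by linarith [hr.1], by linarith [hr.2, hu.2]⟩).sub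
        ((((hasDerivAt_id r).sub_const t).const_mul (v t)).add
          (hasDerivAt_freeDisp a b t r))).congr_deriv ?_
      rw [hv r ⟨hr.1.le, hr.2.le.trans hu.2⟩]
      simp)
  simp at this
  linarith

theorem IsMotion.eq_of_progressionOn (h : IsMotion a b q s e x v y) {t t' : ℝ} (hst : s ≤ t)
    (hte : t' ≤ e) (htt : t < t') (hf : ProgressionOn a b q x v y t t') {u : ℝ}
    (hu : u ∈ Icc t t') :
    x u = y u ∧ v u = v t + freeVel a b t u - q * (u - t) := by
  have hsub : Icc t t' ⊆ Icc s e := Icc_subset_Icc hst hte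
  constructor
  · refine EqOn.of_subset_closure (s := Ioo t t') (fun r hr => (hf r hr).1)
      (h.continuousOn_x.mono hsub) (h.continuousOn_y.mono hsub) Ioo_subset_Icc_self ?_ hu
    rw [closure_Ioo htt.ne]
  · have := eq_of_hasDerivAt_zero (f := fun u => v u - (freeVel a b t u - q * (u - t))) hu.1
      ((h.continuousOn_v.mono ((Icc_subset_Icc_right hu.2).trans hsub)).sub
        (Continuous.continuousOn (by
          have := continuous_freeVel a b t
          fun_prop)))
      (fun r hr => by
        refine ((hf r ⟨hr.1, hr.2.trans_le hu.2⟩).2.2.sub ((hasDerivAt_freeVel a b t r).sub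
          (((hasDerivAt_id r).sub_const t).const_mul q))).congr_deriv ?_
        simp)
    simp at this
    linarith

theorem IsMotion.eq_of_stopOn (h : IsMotion a b q s e x v y) {t t' : ℝ} (hst : s ≤ t)
    (hte : t' ≤ e) (htt : t < t') (hf : StopOn a b q x v y t t') {u : ℝ} (hu : u ∈ Icc t t') :
    x u = y u ∧ v u = 0 := by
  have hsub : Icc t t' ⊆ Icc s e := Icc_subset_Icc hst hte
  have hcl : Icc t t' ⊆ closure (Ioo t t') := by rw [closure_Ioo htt.ne]
  exact ⟨EqOn.of_subset_closure (s := Ioo t t') (fun r hr => (hf r hr).1)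
      (h.continuousOn_x.mono hsub) (h.continuousOn_y.mono hsub) Ioo_subset_Icc_self hcl hu,
    EqOn.of_subset_closure (s := Ioo t t') (g := fun _ => 0) (fun r hr => (hf r hr).2.1)
      (h.continuousOn_v.mono hsub) continuousOn_const Ioo_subset_Icc_self hcl hu⟩

/-- The delimiter stands still during free motion, so a mass moving forward from contact would
penetrate it. -/
theorem IsMotion.not_freeOn_of_vel_pos (h : IsMotion a b q s e x v y) {t t' : ℝ} (hst : s ≤ t)
    (hte : t' ≤ e) (htt : t < t') (hxy : x t = y t) (hv : ∀ u ∈ Ioo t t', 0 < v u) :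
    ¬ FreeOn a b x v y t t' := by
  intro hf
  obtain ⟨u, hu⟩ := exists_between htt
  have h1 : x t < x u := lt_of_hasDerivAt_pos hu.1
    (h.continuousOn_x.mono (Icc_subset_Icc hst (hu.2.le.trans hte)))
    (fun r hr => h.hasDerivAt_x r ⟨by linarith [hr.1], by linarith [hr.2]⟩)
    (fun r hr => hv r ⟨hr.1, hr.2.trans hu.2⟩)
  have h2 := (h.eq_of_freeOn hst hte hf ⟨hu.1.le, hu.2.le⟩).2.2
  have h3 := (hf u hu).1
  linarith

theorem IsMotion.not_freeOn_of_force_pos (h : IsMotion a b q s e x v y) {t t' : ℝ} (hst : s ≤ t)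
    (hte : t' ≤ e) (htt : t < t') (hxy : x t = y t) (hv : v t = 0)
    (hF : ∀ u ∈ Ioo t t', 0 < force a b u) :
    ¬ FreeOn a b x v y t t' := by
  intro hf
  refine h.not_freeOn_of_vel_pos hst hte htt hxy (fun u hu => ?_) hf
  rw [← hv]
  exact lt_of_hasDerivAt_pos hu.1
    (h.continuousOn_v.mono (Icc_subset_Icc hst (hu.2.le.trans hte)))
    (fun r hr => (hf r ⟨hr.1, hr.2.trans hu.2⟩).2.1) (fun r hr => hF r ⟨hr.1, hr.2.trans hu.2⟩)

theorem IsMotion.not_progressionOn_of_force_lt (h : IsMotion a b q s e x v y) {t t' : ℝ}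
    (hst : s ≤ t) (hte : t' ≤ e) (htt : t < t') (hv : v t = 0)
    (hF : ∀ u ∈ Ioo t t', force a b u < q) :
    ¬ ProgressionOn a b q x v y t t' := by
  intro hf
  obtain ⟨u, hu⟩ := exists_between htt
  have h1 : -v t < -v u := lt_of_hasDerivAt_pos (f := fun u => -v u) hu.1
    (h.continuousOn_v.mono (Icc_subset_Icc hst (hu.2.le.trans hte))).neg
    (fun r hr => (hf r ⟨hr.1, hr.2.trans hu.2⟩).2.2.neg)
    (fun r hr => by linarith [hF r ⟨hr.1, hr.2.trans hu.2⟩])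
  have h3 := (hf u hu).2.1
  linarith

theorem IsMotion.exists_progressionOn_of_vel_pos (h : IsMotion a b q s e x v y) {t : ℝ}
    (ht : t ∈ Ico s e) (hxy : x t = y t) (hv : 0 < v t) :
    ∃ t' ∈ Ioc t e, ProgressionOn a b q x v y t t' := by
  obtain ⟨t', ht', hreg⟩ := h.exists_regime ht
  have hpos : ∀ᶠ u in 𝓝[>] t, 0 < v u := by
    have h1 : ContinuousWithinAt v (Ioc t e) t :=
      (h.continuousOn_v t ⟨ht.1, ht.2.le⟩).mono (fun u hu => ⟨ht.1.trans hu.1.le, hu.2⟩)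
    have h2 := h1.eventually (lt_mem_nhds hv)
    rwa [nhdsWithin_Ioc_eq_nhdsGT ht.2] at h2
  obtain ⟨w, hw, hw2⟩ := (mem_nhdsGT_iff_exists_Ioo_subset).1 hpos
  have hw1 : t < min t' w := lt_min ht'.1 hw
  have hw3 : ∀ u ∈ Ioo t (min t' w), 0 < v u := fun u hu =>
    hw2 ⟨hu.1, hu.2.trans_le (min_le_right _ _)⟩
  rcases hreg with hf | hf | hf
  · exact absurd (hf.mono le_rfl (min_le_left _ _)) (h.not_freeOn_of_vel_pos ht.1
      ((min_le_left _ _).trans ht'.2) hw1 hxy hw3)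
  · exact ⟨t', ht', hf⟩
  · obtain ⟨u, hu⟩ := exists_between hw1
    have := (hf u ⟨hu.1, hu.2.trans_le (min_le_left _ _)⟩).2.1
    linarith [hw3 u hu]

/-- By exclusion: a positive force forbids free motion, a force below q forbids progression from
rest. -/
theorem IsMotion.exists_stopOn (h : IsMotion a b q s e x v y) {t m : ℝ}
    (ht : t ∈ Ico s e) (hxy : x t = y t) (hv : v t = 0) (htm : t < m)
    (hF : ∀ u ∈ Ioo t m, 0 < force a b u ∧ force a b u < q) :
    ∃ t' ∈ Ioc t e, StopOn a b q x v y t t' := by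
  obtain ⟨t', ht', hreg⟩ := h.exists_regime ht
  have hw1 : t < min t' m := lt_min ht'.1 htm
  have hle := min_le_left t' m
  have hF' : ∀ u ∈ Ioo t (min t' m), 0 < force a b u ∧ force a b u < q := fun u hu =>
    hF u ⟨hu.1, hu.2.trans_le (min_le_right _ _)⟩
  rcases hreg with hf | hf | hf
  · exact absurd (hf.mono le_rfl hle) (h.not_freeOn_of_force_pos ht.1
      (hle.trans ht'.2) hw1 hxy hv fun u hu => (hF' u hu).1)
  · exact absurd (hf.mono le_rfl hle) (h.not_progressionOn_of_force_lt ht.1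
      (hle.trans ht'.2) hw1 hv fun u hu => (hF' u hu).2)
  · exact ⟨t', ht', hf⟩

theorem IsMotion.exists_progressionOn_of_lt_force (h : IsMotion a b q s e x v y) {t m : ℝ}
    (hq : 0 ≤ q) (ht : t ∈ Ico s e) (hxy : x t = y t) (hv : v t = 0) (htm : t < m)
    (hF : ∀ u ∈ Ioo t m, q < force a b u) :
    ∃ t' ∈ Ioc t e, ProgressionOn a b q x v y t t' := by
  obtain ⟨t', ht', hreg⟩ := h.exists_regime ht
  have hw1 : t < min t' m := lt_min ht'.1 htm
  have hle := min_le_left t' m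
  have hF' : ∀ u ∈ Ioo t (min t' m), q < force a b u := fun u hu =>
    hF u ⟨hu.1, hu.2.trans_le (min_le_right _ _)⟩
  rcases hreg with hf | hf | hf
  · exact absurd (hf.mono le_rfl hle) (h.not_freeOn_of_force_pos ht.1
      (hle.trans ht'.2) hw1 hxy hv fun u hu => hq.trans_lt (hF' u hu))
  · exact ⟨t', ht', hf⟩
  · obtain ⟨u, hu⟩ := exists_between hw1
    have := (hf u ⟨hu.1, hu.2.trans_le hle⟩).2.2.2.2
    linarith [hF' u hu]

theorem IsMotion.toFree_of_force_neg (h : IsMotion a b q s e x v y) {t m : ℝ}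
    (hq : 0 ≤ q) (ht : t ∈ Ico s e) (hxy : x t = y t) (hv : v t = 0) (htm : t < m)
    (hF : ∀ u ∈ Ioo t m, force a b u < 0) : ToFree x v y t := by
  obtain ⟨t', ht', hreg⟩ := h.exists_regime ht
  have hw1 : t < min t' m := lt_min ht'.1 htm
  have hle := min_le_left t' m
  have hF' : ∀ u ∈ Ioo t (min t' m), force a b u < 0 := fun u hu =>
    hF u ⟨hu.1, hu.2.trans_le (min_le_right _ _)⟩
  rcases hreg with hf | hf | hf
  · exact ⟨hxy, hv, mem_of_superset (Ioo_mem_nhdsGT ht'.1) fun u hu => (hf u hu).1⟩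
  · exact absurd (hf.mono le_rfl hle) (h.not_progressionOn_of_force_lt ht.1
      (hle.trans ht'.2) hw1 hv fun u hu => (hF' u hu).trans_le hq)
  · obtain ⟨u, hu⟩ := exists_between hw1
    have := (hf u ⟨hu.1, hu.2.trans_le hle⟩).2.2.2.1
    linarith [hF' u hu]

theorem IsMotion.exists_freeOn_of_eventually_lt (h : IsMotion a b q s e x v y) {t : ℝ}
    (ht : t ∈ Ico s e) (hlt : ∀ᶠ u in 𝓝[>] t, x u < y u) :
    ∃ t' ∈ Ioc t e, FreeOn a b x v y t t' := by
  obtain ⟨t', ht', hreg⟩ := h.exists_regime ht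
  obtain ⟨u, hu1, hu2⟩ := (hlt.and (Ioo_mem_nhdsGT ht'.1)).exists
  rcases hreg with hf | hf | hf
  · exact ⟨t', ht', hf⟩
  · exact absurd (hf u hu2).1 hu1.ne
  · exact absurd (hf u hu2).1 hu1.ne

/-! ### Continuation of a motion through a regime -/

/-- While the explicit displacement is negative, contact stays lost by continuity, so only the free
regime can continue; at `r` itself this is the definition of a transition. -/
theorem IsMotion.free_flight (h : IsMotion a b q s e x v y) {r m : ℝ} (hr : s ≤ r) (hm : m ≤ e)
    (hfree : ToFree x v y r) (hD : ∀ t ∈ Ioo r m, freeDisp a b r t < 0) {t : ℝ}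
    (ht : t ∈ Icc r m) :
    v t = freeVel a b r t ∧ x t = y r + freeDisp a b r t ∧ y t = y r := by
  have hsub : Icc r m ⊆ Icc s e := Icc_subset_Icc hr hm
  have := eqOn_Icc_of_forall_eventually (f := fun t => (v t, x t, y t))
    (g := fun t => (freeVel a b r t, y r + freeDisp a b r t, y r)) (r := r) (m := m)
    ((h.continuousOn_v.mono hsub).prodMk ((h.continuousOn_x.mono hsub).prodMk
      (h.continuousOn_y.mono hsub)))
    ((continuous_freeVel a b r).prodMk ((continuous_const.add (continuous_freeDisp a b r)).prodMk
      continuous_const)).continuousOn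
    (by simp [hfree.1, hfree.2.1])
    (by
      intro t ht heq
      simp only [Prod.mk.injEq] at heq
      obtain ⟨h1, h2, h3⟩ := heq
      have hte : t ∈ Ico s e := ⟨hr.trans ht.1, ht.2.trans_le hm⟩
      have hlt : ∀ᶠ u in 𝓝[>] t, x u < y u := by
        rcases ht.1.eq_or_lt with rfl | hrt
        · exact hfree.2.2
        · have hxy : x t < y t := by linarith [hD t ⟨hrt, ht.2⟩]
          have hx := (h.continuousOn_x t ⟨hte.1, hte.2.le⟩).mono
            (fun u (hu : u ∈ Ioc t e) => ⟨hte.1.trans hu.1.le, hu.2⟩)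
          have hy := (h.continuousOn_y t ⟨hte.1, hte.2.le⟩).mono
            (fun u (hu : u ∈ Ioc t e) => ⟨hte.1.trans hu.1.le, hu.2⟩)
          have := hx.eventually_lt hy hxy
          rwa [nhdsWithin_Ioc_eq_nhdsGT hte.2] at this
      obtain ⟨t', ht', hf⟩ := h.exists_freeOn_of_eventually_lt hte hlt
      filter_upwards [Ioo_mem_nhdsGT ht'.1] with u hu
      obtain ⟨e1, e2, e3⟩ := h.eq_of_freeOn hte.1 ht'.2 hf ⟨hu.1.le, hu.2.le⟩
      simp only [Prod.mk.injEq]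
      rw [e1, e2, e3, h1, h2, h3, freeVel_add]
      refine ⟨rfl, ?_, rfl⟩
      unfold freeVel freeDisp
      ring) ht
  simpa using this

/-- A positive velocity in contact forces progression to go on. The start is a separate hypothesis
because the velocity may vanish at `r`. -/
theorem IsMotion.progression (h : IsMotion a b q s e x v y) {r m : ℝ} (hr : s ≤ r) (hm : m ≤ e)
    (hxy : x r = y r) (hstart : r < m → ∃ t' ∈ Ioc r e, ProgressionOn a b q x v y r t')
    (hW : ∀ t ∈ Ioo r m, 0 < v r + freeVel a b r t - q * (t - r)) {t : ℝ}
    (ht : t ∈ Icc r m) :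
    x t = y t ∧ v t = v r + freeVel a b r t - q * (t - r) := by
  have hsub : Icc r m ⊆ Icc s e := Icc_subset_Icc hr hm
  have hcv := continuous_freeVel a b r
  have := eqOn_Icc_of_forall_eventually (f := fun t => (x t - y t, v t))
    (g := fun t => ((0 : ℝ), v r + freeVel a b r t - q * (t - r))) (r := r) (m := m)
    (((h.continuousOn_x.mono hsub).sub (h.continuousOn_y.mono hsub)).prodMk
      (h.continuousOn_v.mono hsub))
    (Continuous.continuousOn (by fun_prop))
    (by simp [hxy])
    (by
      intro t ht heq
      simp only [Prod.mk.injEq] at heq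
      obtain ⟨h1, h2⟩ := heq
      have hte : t ∈ Ico s e := ⟨hr.trans ht.1, ht.2.trans_le hm⟩
      obtain ⟨t', ht', hf⟩ : ∃ t' ∈ Ioc t e, ProgressionOn a b q x v y t t' := by
        rcases ht.1.eq_or_lt with rfl | hrt
        · exact hstart ht.2
        · exact h.exists_progressionOn_of_vel_pos hte (by linarith) (h2 ▸ hW t ⟨hrt, ht.2⟩)
      filter_upwards [Ioo_mem_nhdsGT ht'.1] with u hu
      obtain ⟨e1, e2⟩ := h.eq_of_progressionOn hte.1 ht'.2 ht'.1 hf ⟨hu.1.le, hu.2.le⟩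
      simp only [Prod.mk.injEq]
      rw [e1, e2, h2, ← freeVel_add a b r t u]
      exact ⟨by ring, by ring⟩) ht
  simp only [Prod.mk.injEq] at this
  exact ⟨by linarith, this.2⟩

theorem IsMotion.stay_stopped (h : IsMotion a b q s e x v y) {r m : ℝ} (hr : s ≤ r) (hm : m ≤ e)
    (hxy : x r = y r) (hv : v r = 0)
    (hF : ∀ t ∈ Ioo r m, 0 < force a b t ∧ force a b t < q) {t : ℝ} (ht : t ∈ Icc r m) :
    x t = y t ∧ v t = 0 := by
  have hsub : Icc r m ⊆ Icc s e := Icc_subset_Icc hr hm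
  have := eqOn_Icc_of_forall_eventually (f := fun t => (x t - y t, v t))
    (g := fun t => ((0 : ℝ), (0 : ℝ))) (r := r) (m := m)
    (((h.continuousOn_x.mono hsub).sub (h.continuousOn_y.mono hsub)).prodMk
      (h.continuousOn_v.mono hsub)) continuousOn_const (by simp [hxy, hv])
    (by
      intro t ht heq
      simp only [Prod.mk.injEq] at heq
      obtain ⟨h1, h2⟩ := heq
      have hte : t ∈ Ico s e := ⟨hr.trans ht.1, ht.2.trans_le hm⟩
      obtain ⟨t', ht', hf⟩ := h.exists_stopOn hte (by linarith) h2 ht.2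
        fun u hu => hF u ⟨ht.1.trans_lt hu.1, hu.2⟩
      filter_upwards [Ioo_mem_nhdsGT ht'.1] with u hu
      obtain ⟨e1, e2⟩ := h.eq_of_stopOn hte.1 ht'.2 ht'.1 hf ⟨hu.1.le, hu.2.le⟩
      simp [e1, e2]) ht
  simp only [Prod.mk.injEq] at this
  exact ⟨by linarith, this.2⟩

end Motion

/-! ### Construction of motions -/

/-- The function equal to `f` up to time `m` and to `g` afterwards. -/
noncomputable def glueAt (m : ℝ) (f g : ℝ → ℝ) (t : ℝ) : ℝ := if t ≤ m then f t else g t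

theorem glueAt_of_le {m t : ℝ} (f g : ℝ → ℝ) (h : t ≤ m) : glueAt m f g t = f t := if_pos h

theorem glueAt_of_lt {m t : ℝ} (f g : ℝ → ℝ) (h : m < t) : glueAt m f g t = g t := if_neg (not_le.2 h)

theorem glueAt_of_ge {m t : ℝ} {f g : ℝ → ℝ} (hm : f m = g m) (h : m ≤ t) : glueAt m f g t = g t := by
  rcases h.eq_or_lt with rfl | h
  · rw [glueAt_of_le _ _ le_rfl, hm]
  · exact glueAt_of_lt _ _ h

theorem glueAt_eventuallyEq_left {m t : ℝ} (f g : ℝ → ℝ) (h : t < m) : glueAt m f g =ᶠ[𝓝 t] f := by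
  filter_upwards [Iio_mem_nhds h] with u hu using glueAt_of_le f g (le_of_lt hu)

theorem glueAt_eventuallyEq_right {m t : ℝ} (f g : ℝ → ℝ) (h : m < t) : glueAt m f g =ᶠ[𝓝 t] g := by
  filter_upwards [Ioi_mem_nhds h] with u hu using glueAt_of_lt f g hu

theorem continuousOn_glueAt {m s e : ℝ} {f g : ℝ → ℝ} (hsm : s ≤ m) (hme : m ≤ e)
    (hf : ContinuousOn f (Icc s m)) (hg : ContinuousOn g (Icc m e)) (hm : f m = g m) :
    ContinuousOn (glueAt m f g) (Icc s e) := by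
  rw [← Icc_union_Icc_eq_Icc hsm hme]
  exact (hf.congr fun t ht => glueAt_of_le f g ht.2).union_of_isClosed
    (hg.congr fun t ht => glueAt_of_ge hm ht.1) isClosed_Icc isClosed_Icc

/-! ### One-sided derivatives, gluing and explicit pieces -/

section

variable {a b q s m e : ℝ} {x v y x' v' y' : ℝ → ℝ}

/-- A motion has derivatives only at interior times; the continuous velocity supplies one-sided
derivatives at the ends, which are needed at a gluing point. -/
theorem IsMotion.hasDerivWithinAt_right (h : IsMotion a b q s e x v y) (hse : s < e) :
    HasDerivWithinAt x (v s) (Ici s) s := by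
  refine hasDerivWithinAt_Ici_of_tendsto_deriv (s := Ioo s e)
    (fun t ht => (h.hasDerivAt_x t ht).differentiableAt.differentiableWithinAt)
    ((h.continuousOn_x s (left_mem_Icc.2 hse.le)).mono Ioo_subset_Icc_self)
    (Ioo_mem_nhdsGT hse) ?_
  have h1 : Tendsto v (𝓝[>] s) (𝓝 (v s)) := by
    have := (h.continuousOn_v s (left_mem_Icc.2 hse.le)).mono Ioo_subset_Icc_self
    rwa [ContinuousWithinAt, nhdsWithin_Ioo_eq_nhdsGT hse] at this
  refine h1.congr' ?_
  filter_upwards [Ioo_mem_nhdsGT hse] with t ht using (h.hasDerivAt_x t ht).deriv.symm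

theorem IsMotion.hasDerivWithinAt_left (h : IsMotion a b q s e x v y) (hse : s < e) :
    HasDerivWithinAt x (v e) (Iic e) e := by
  refine hasDerivWithinAt_Iic_of_tendsto_deriv (s := Ioo s e)
    (fun t ht => (h.hasDerivAt_x t ht).differentiableAt.differentiableWithinAt)
    ((h.continuousOn_x e (right_mem_Icc.2 hse.le)).mono Ioo_subset_Icc_self)
    (Ioo_mem_nhdsLT hse) ?_
  have h1 : Tendsto v (𝓝[<] e) (𝓝 (v e)) := by
    have := (h.continuousOn_v e (right_mem_Icc.2 hse.le)).mono Ioo_subset_Icc_self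
    rwa [ContinuousWithinAt, nhdsWithin_Ioo_eq_nhdsLT hse] at this
  refine h1.congr' ?_
  filter_upwards [Ioo_mem_nhdsLT hse] with t ht using (h.hasDerivAt_x t ht).deriv.symm

/-- A regime only depends on the motion inside the time interval. -/
theorem regime_congr {r u : ℝ} (hx : EqOn x' x (Ioo r u)) (hv : EqOn v' v (Ioo r u))
    (hy : EqOn y' y (Ioo r u))
    (h : FreeOn a b x v y r u ∨ ProgressionOn a b q x v y r u ∨ StopOn a b q x v y r u) :
    FreeOn a b x' v' y' r u ∨ ProgressionOn a b q x' v' y' r u ∨ StopOn a b q x' v' y' r u := by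
  have hev : ∀ {f g : ℝ → ℝ}, EqOn f g (Ioo r u) → ∀ t ∈ Ioo r u, f =ᶠ[𝓝 t] g := fun hfg t ht =>
    mem_of_superset (isOpen_Ioo.mem_nhds ht) hfg
  rcases h with h | h | h
  · refine Or.inl fun t ht => ?_
    rw [hx ht, hy ht]
    exact ⟨(h t ht).1, (h t ht).2.1.congr_of_eventuallyEq (hev hv t ht),
      (h t ht).2.2.congr_of_eventuallyEq (hev hy t ht)⟩
  · refine Or.inr (Or.inl fun t ht => ?_)
    rw [hx ht, hy ht, hv ht]
    exact ⟨(h t ht).1, (h t ht).2.1, (h t ht).2.2.congr_of_eventuallyEq (hev hv t ht)⟩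
  · refine Or.inr (Or.inr fun t ht => ?_)
    rw [hx ht, hy ht, hv ht]
    exact ⟨(h t ht).1, (h t ht).2.1, (h t ht).2.2.1.congr_of_eventuallyEq (hev hy t ht),
      (h t ht).2.2.2⟩

theorem IsMotion.glue (h : IsMotion a b q s m x v y) (h' : IsMotion a b q m e x' v' y')
    (hsm : s < m) (hme : m < e) (hx : x m = x' m) (hv : v m = v' m) (hy : y m = y' m) :
    IsMotion a b q s e (glueAt m x x') (glueAt m v v') (glueAt m y y') where
  continuousOn_x := continuousOn_glueAt hsm.le hme.le h.continuousOn_x h'.continuousOn_x hx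
  continuousOn_v := continuousOn_glueAt hsm.le hme.le h.continuousOn_v h'.continuousOn_v hv
  continuousOn_y := continuousOn_glueAt hsm.le hme.le h.continuousOn_y h'.continuousOn_y hy
  hasDerivAt_x := by
    intro t ht
    rcases lt_trichotomy t m with htm | rfl | htm
    · rw [glueAt_of_le _ _ htm.le]
      exact (h.hasDerivAt_x t ⟨ht.1, htm⟩).congr_of_eventuallyEq (glueAt_eventuallyEq_left _ _ htm)
    · rw [glueAt_of_le _ _ le_rfl]
      have h1 : HasDerivWithinAt (glueAt t x x') (v t) (Iic t) t :=
        (h.hasDerivWithinAt_left hsm).congr (fun u hu => glueAt_of_le _ _ hu) (glueAt_of_le _ _ le_rfl)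
      have h2 : HasDerivWithinAt (glueAt t x x') (v t) (Ici t) t := by
        rw [hv]
        exact (h'.hasDerivWithinAt_right hme).congr (fun u hu => glueAt_of_ge hx hu)
          (glueAt_of_ge hx le_rfl)
      have := h1.union h2
      rwa [Iic_union_Ici, hasDerivWithinAt_univ] at this
    · rw [glueAt_of_lt _ _ htm]
      exact (h'.hasDerivAt_x t ⟨htm, ht.2⟩).congr_of_eventuallyEq (glueAt_eventuallyEq_right _ _ htm)
  le := by
    intro t ht
    rcases le_or_gt t m with htm | htm
    · rw [glueAt_of_le _ _ htm, glueAt_of_le _ _ htm]; exact h.le t ⟨ht.1, htm⟩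
    · rw [glueAt_of_lt _ _ htm, glueAt_of_lt _ _ htm]; exact h'.le t ⟨htm.le, ht.2⟩
  monotoneOn_y := by
    intro t ht u hu htu
    rcases le_or_gt u m with hum | hum
    · rw [glueAt_of_le _ _ hum, glueAt_of_le _ _ (htu.trans hum)]
      exact h.monotoneOn_y ⟨ht.1, htu.trans hum⟩ ⟨hu.1, hum⟩ htu
    · rw [glueAt_of_lt _ _ hum]
      rcases le_or_gt t m with htm | htm
      · rw [glueAt_of_le _ _ htm]
        refine (h.monotoneOn_y ⟨ht.1, htm⟩ ⟨hsm.le, le_rfl⟩ htm).trans ?_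
        rw [hy]
        exact h'.monotoneOn_y ⟨le_rfl, hme.le⟩ ⟨hum.le, hu.2⟩ hum.le
      · rw [glueAt_of_lt _ _ htm]
        exact h'.monotoneOn_y ⟨htm.le, ht.2⟩ ⟨hum.le, hu.2⟩ htu
  regimes := by
    obtain ⟨n, τ, h0, hn, hτ⟩ := h.regimes
    obtain ⟨n', τ', h0', hn', hτ'⟩ := h'.regimes
    have hle : ∀ j ≤ n, τ j ≤ m := by
      intro j hj
      induction hj using Nat.decreasingInduction with
      | self => exact hn.le
      | of_succ k hk ih => exact (hτ k hk).1.le.trans ih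
    have hge : ∀ j ≤ n', m ≤ τ' j := by
      intro j
      induction j with
      | zero => intro _; exact h0'.ge
      | succ j ih => intro hj; exact (ih (by omega)).trans (hτ' j (by omega)).1.le
    refine ⟨n + n', fun i => if i ≤ n then τ i else τ' (i - n), by simp [h0], ?_, ?_⟩
    -- An empty second partition would give m = e.
    · by_cases hn0 : n' = 0
      · subst hn0; rw [hn'] at h0'; exact absurd h0' hme.ne'
      · simp [hn0, hn']
    · intro i hi
      rcases lt_or_ge i n with hin | hin
      · simp only [hin.le, Nat.succ_le_of_lt hin, if_true]
        refine ⟨(hτ i hin).1, regime_congr ?_ ?_ ?_ (hτ i hin).2⟩ <;>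
        exact fun t ht => glueAt_of_le _ _ (ht.2.le.trans (hle _ hin))
      -- At `i = n` the list still reads `τ n`, which equals `m` and so `τ' 0`.
      · have e1 : (if i ≤ n then τ i else τ' (i - n)) = τ' (i - n) := by
          rcases hin.eq_or_lt with rfl | h1
          · simp [hn, h0']
          · simp [h1]
        have e2 : (if i + 1 ≤ n then τ (i + 1) else τ' (i + 1 - n)) = τ' (i - n + 1) := by
          rw [if_neg (by omega)]
          congr 1
          omega
        beta_reduce
        rw [e1, e2]
        have h3 := hτ' (i - n) (by omega)
        have h4 := hge (i - n) (by omega)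
        refine ⟨h3.1, regime_congr ?_ ?_ ?_ h3.2⟩ <;>
        exact fun t ht => glueAt_of_lt _ _ (h4.trans_lt ht.1)

theorem isMotion_free (c : ℝ) (hse : s < e) (hD : ∀ t ∈ Ioo s e, freeDisp a b s t < 0)
    (hDe : freeDisp a b s e ≤ 0) :
    IsMotion a b q s e (fun t => c + freeDisp a b s t) (freeVel a b s) (fun _ => c) where
  continuousOn_x := (continuous_const.add (continuous_freeDisp a b s)).continuousOn
  continuousOn_v := (continuous_freeVel a b s).continuousOn
  continuousOn_y := continuousOn_const
  hasDerivAt_x t _ := (hasDerivAt_freeDisp a b s t).const_add c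
  le t ht := by
    rcases ht.1.eq_or_lt with rfl | h1
    · simp
    · rcases ht.2.eq_or_lt with rfl | h2
      · simpa using hDe
      · simpa using (hD t ⟨h1, h2⟩).le
  monotoneOn_y := monotoneOn_const
  regimes := ⟨1, fun i => if i = 0 then s else e, by simp, by simp, fun i hi => by
    obtain rfl : i = 0 := by omega
    exact ⟨by simpa using hse, Or.inl fun t ht => ⟨by simpa using hD t (by simpa using ht),
      hasDerivAt_freeVel a b s t, hasDerivAt_const t c⟩⟩⟩

theorem isMotion_progression (c v₀ : ℝ) (hse : s < e)
    (hv : ∀ t ∈ Ioo s e, 0 < v₀ + freeVel a b s t - q * (t - s)) :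
    IsMotion a b q s e (fun t => c + v₀ * (t - s) + freeDisp a b s t - q * ((t - s) ^ 2 / 2))
      (fun t => v₀ + freeVel a b s t - q * (t - s))
      (fun t => c + v₀ * (t - s) + freeDisp a b s t - q * ((t - s) ^ 2 / 2)) := by
  have hcd := continuous_freeDisp a b s
  have hcv := continuous_freeVel a b s
  have hd : ∀ t, HasDerivAt (fun t => c + v₀ * (t - s) + freeDisp a b s t - q * ((t - s) ^ 2 / 2))
      (v₀ + freeVel a b s t - q * (t - s)) t := by
    intro t
    refine ((((((hasDerivAt_id t).sub_const s).const_mul v₀).const_add c).add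
      (hasDerivAt_freeDisp a b s t)).sub
      (((((hasDerivAt_id t).sub_const s).pow 2).div_const 2).const_mul q)).congr_deriv ?_
    simp
  have hc := continuous_iff_continuousAt.2 fun t => (hd t).continuousAt
  exact
  { continuousOn_x := hc.continuousOn
    continuousOn_v := by fun_prop
    continuousOn_y := hc.continuousOn
    hasDerivAt_x := fun t _ => hd t
    le := fun t _ => le_rfl
    monotoneOn_y := by
      refine monotoneOn_of_deriv_nonneg (convex_Icc s e) hc.continuousOn
        (fun t _ => (hd t).differentiableAt.differentiableWithinAt) fun t ht => ?_
      rw [interior_Icc] at ht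
      rw [(hd t).deriv]
      exact (hv t ht).le
    regimes := ⟨1, fun i => if i = 0 then s else e, by simp, by simp, fun i hi => by
      obtain rfl : i = 0 := by omega
      refine ⟨by simpa using hse, Or.inr (Or.inl fun t ht => ⟨rfl, hv t (by simpa using ht), ?_⟩)⟩
      refine (((hasDerivAt_freeVel a b s t).const_add v₀).sub
        (((hasDerivAt_id t).sub_const s).const_mul q)).congr_deriv ?_
      simp⟩ }

theorem isMotion_stop (c : ℝ) (hse : s < e)
    (hF : ∀ t ∈ Ioo s e, 0 < force a b t ∧ force a b t < q) :
    IsMotion a b q s e (fun _ => c) (fun _ => 0) (fun _ => c) where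
  continuousOn_x := continuousOn_const
  continuousOn_v := continuousOn_const
  continuousOn_y := continuousOn_const
  hasDerivAt_x t _ := hasDerivAt_const t c
  le t _ := le_rfl
  monotoneOn_y := monotoneOn_const
  regimes := ⟨1, fun i => if i = 0 then s else e, by simp, by simp, fun i hi => by
    obtain rfl : i = 0 := by omega
    refine ⟨by simpa using hse, Or.inr (Or.inr fun t ht => ⟨rfl, rfl, hasDerivAt_const t c, ?_⟩)⟩
    have := hF t (by simpa using ht)
    exact ⟨this.1.le, this.2.le⟩⟩

/-- Some motion starts with a transition to free motion at time `s`, and is in contact with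
velocity `w` at time `m`. -/
def ReachesContact (a b q s m w : ℝ) : Prop :=
  s < m ∧ ∃ x v y : ℝ → ℝ, IsMotion a b q s m x v y ∧ ToFree x v y s ∧ x m = y m ∧ v m = w

theorem ToFree.glue (h : ToFree x v y s) (hsm : s < m) :
    ToFree (glueAt m x x') (glueAt m v v') (glueAt m y y') s := by
  refine ⟨?_, ?_, ?_⟩
  · rw [glueAt_of_le _ _ hsm.le, glueAt_of_le _ _ hsm.le, h.1]
  · rw [glueAt_of_le _ _ hsm.le, h.2.1]
  · filter_upwards [h.2.2, Ioo_mem_nhdsGT hsm] with u hu hum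
    rwa [glueAt_of_le _ _ hum.2.le, glueAt_of_le _ _ hum.2.le]

theorem ReachesContact.of_free (hse : s < e) (hD : ∀ t ∈ Ioo s e, freeDisp a b s t < 0)
    (hDe : freeDisp a b s e = 0) : ReachesContact a b q s e (freeVel a b s e) := by
  refine ⟨hse, _, _, _, isMotion_free 0 hse hD hDe.le, ⟨by simp, by simp, ?_⟩, by simp [hDe], rfl⟩
  filter_upwards [Ioo_mem_nhdsGT hse] with t ht
  simpa using hD t ht

theorem ReachesContact.progression {w : ℝ} (h : ReachesContact a b q s m w) (hme : m ≤ e)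
    (hv : ∀ t ∈ Ioo m e, 0 < w + freeVel a b m t - q * (t - m)) :
    ReachesContact a b q s e (w + freeVel a b m e - q * (e - m)) := by
  rcases hme.eq_or_lt with rfl | hme
  · simpa using h
  obtain ⟨hsm, x, v, y, hM, hF, hxy, rfl⟩ := h
  refine ⟨hsm.trans hme, _, _, _, hM.glue (isMotion_progression (x m) (v m) hme hv) hsm hme
    (by simp) (by simp) (by simp [hxy]), hF.glue hsm, ?_, ?_⟩
  · rw [glueAt_of_lt _ _ hme, glueAt_of_lt _ _ hme]
  · rw [glueAt_of_lt _ _ hme]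

theorem ReachesContact.stay_stopped (h : ReachesContact a b q s m 0) (hme : m ≤ e)
    (hF : ∀ t ∈ Ioo m e, 0 < force a b t ∧ force a b t < q) :
    ReachesContact a b q s e 0 := by
  rcases hme.eq_or_lt with rfl | hme
  · exact h
  obtain ⟨hsm, x, v, y, hM, hT, hxy, hv⟩ := h
  refine ⟨hsm.trans hme, _, _, _, hM.glue (isMotion_stop (x m) hme hF) hsm hme
    (by simp) (by simp [hv]) (by simp [hxy]), hT.glue hsm, ?_, ?_⟩
  · rw [glueAt_of_lt _ _ hme, glueAt_of_lt _ _ hme]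
  · rw [glueAt_of_lt _ _ hme]

theorem ReachesContact.exists_motion_beyond (h : ReachesContact a b q s m 0) (hme : m < e)
    (hD : ∀ t ∈ Ioo m e, freeDisp a b m t < 0) (hDe : freeDisp a b m e ≤ 0) :
    ∃ x v y : ℝ → ℝ, IsMotion a b q s e x v y ∧ ToFree x v y s := by
  obtain ⟨hsm, x, v, y, hM, hT, hxy, hv⟩ := h
  exact ⟨_, _, _, hM.glue (isMotion_free (x m) hme hD hDe) hsm hme
    (by simp) (by simp [hv]) (by simp [hxy]), hT.glue hsm⟩

end

/-! ### Signs of the force -/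

/-- The angle `β` for which the zeros of the force are `π + β` and `2π - β`. -/
noncomputable def zeroAngle (a b : ℝ) : ℝ := Real.arcsin (2 * b / a)

/-- The phase in `[0, π/2]` at which the force reaches the friction `q` from below. -/
noncomputable def slipPhase (a b q : ℝ) : ℝ := Real.arcsin ((q - 2 * b) / a)

/-- The parameters are such that a slip starting from rest ends before the phase `π + β`. -/
structure Admissible (a b q : ℝ) : Prop where
  ha : 0 < a
  hb : 0 < b
  hba : b < a / 2
  hbq : 2 * b < q
  hqa : q < a
  -- The velocity at π + β of a slip from rest at γ is negative.
  hslip : a * (Real.cos (slipPhase a b q) + Real.cos (zeroAngle a b)) <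
    (q - 2 * b) * (Real.pi + zeroAngle a b - slipPhase a b q)

/-- The sine is the cosine of the distance to π/2, and t is closer to π/2 than α. -/
theorem sin_lt_sin_of_mem_Ioo {α t : ℝ} (hα : α ∈ Icc (-(Real.pi / 2)) (Real.pi / 2))
    (ht : t ∈ Ioo α (Real.pi - α)) : Real.sin α < Real.sin t := by
  rw [← Real.cos_pi_div_two_sub α, ← Real.cos_pi_div_two_sub t, ← Real.cos_abs (Real.pi / 2 - t)]
  refine Real.cos_lt_cos_of_nonneg_of_le_pi (abs_nonneg _) (by linarith [hα.1]) ?_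
  rw [abs_lt]
  constructor <;> linarith [ht.1, ht.2]

theorem sin_lt_sin_of_mem_Ioo' {α t : ℝ} (hα : α ∈ Icc (-(Real.pi / 2)) (Real.pi / 2))
    (ht : t ∈ Ioo (Real.pi - α) (2 * Real.pi + α)) : Real.sin t < Real.sin α := by
  have := sin_lt_sin_of_mem_Ioo (α := -α) (t := t - Real.pi)
    ⟨by linarith [hα.2], by linarith [hα.1]⟩ ⟨by linarith [ht.1], by linarith [ht.2]⟩
  rw [Real.sin_neg, Real.sin_sub_pi] at this
  linarith

namespace Admissible

variable {a b q : ℝ}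

theorem zeroAngle_mem (hA : Admissible a b q) :
    0 < zeroAngle a b ∧ zeroAngle a b < Real.pi / 2 := by
  have h1 : 0 < 2 * b / a := by have := hA.ha; have := hA.hb; positivity
  have h2 : 2 * b / a < 1 := by rw [div_lt_one hA.ha]; linarith [hA.hba]
  exact ⟨Real.arcsin_pos.2 h1, Real.arcsin_lt_pi_div_two.2 h2⟩

theorem slipPhase_mem (hA : Admissible a b q) :
    0 < slipPhase a b q ∧ slipPhase a b q < Real.pi / 2 := by
  have h1 : 0 < (q - 2 * b) / a := div_pos (by linarith [hA.hbq]) hA.ha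
  have h2 : (q - 2 * b) / a < 1 := by rw [div_lt_one hA.ha]; linarith [hA.hqa, hA.hb]
  exact ⟨Real.arcsin_pos.2 h1, Real.arcsin_lt_pi_div_two.2 h2⟩

theorem sin_zeroAngle (hA : Admissible a b q) : a * Real.sin (zeroAngle a b) = 2 * b := by
  have h1 : 0 < 2 * b / a := by have := hA.ha; have := hA.hb; positivity
  have h2 : 2 * b / a < 1 := by rw [div_lt_one hA.ha]; linarith [hA.hba]
  rw [zeroAngle, Real.sin_arcsin (by linarith) h2.le]
  have := hA.ha
  field_simp

theorem sin_slipPhase (hA : Admissible a b q) : a * Real.sin (slipPhase a b q) = q - 2 * b := by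
  have h1 : 0 < (q - 2 * b) / a := div_pos (by linarith [hA.hbq]) hA.ha
  have h2 : (q - 2 * b) / a < 1 := by rw [div_lt_one hA.ha]; linarith [hA.hqa, hA.hb]
  rw [slipPhase, Real.sin_arcsin (by linarith) h2.le]
  have := hA.ha
  field_simp

theorem force_pos (hA : Admissible a b q) {t : ℝ} (k : ℤ)
    (h1 : -zeroAngle a b + k * (2 * Real.pi) < t)
    (h2 : t < Real.pi + zeroAngle a b + k * (2 * Real.pi)) : 0 < force a b t := by
  have hz := hA.zeroAngle_mem
  have := sin_lt_sin_of_mem_Ioo (α := -zeroAngle a b) (t := t - k * (2 * Real.pi))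
    ⟨by linarith, by linarith⟩ ⟨by linarith, by linarith⟩
  rw [Real.sin_sub_int_mul_two_pi, Real.sin_neg] at this
  have := mul_lt_mul_of_pos_left this hA.ha
  unfold force
  linarith [hA.sin_zeroAngle]

theorem force_neg (hA : Admissible a b q) {t : ℝ} (k : ℤ)
    (h1 : Real.pi + zeroAngle a b + k * (2 * Real.pi) < t)
    (h2 : t < 2 * Real.pi - zeroAngle a b + k * (2 * Real.pi)) : force a b t < 0 := by
  have hz := hA.zeroAngle_mem
  have := sin_lt_sin_of_mem_Ioo' (α := -zeroAngle a b) (t := t - k * (2 * Real.pi))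
    ⟨by linarith, by linarith⟩ ⟨by linarith, by linarith⟩
  rw [Real.sin_sub_int_mul_two_pi, Real.sin_neg] at this
  have := mul_lt_mul_of_pos_left this hA.ha
  unfold force
  linarith [hA.sin_zeroAngle]

theorem lt_force (hA : Admissible a b q) {t : ℝ} (k : ℤ)
    (h1 : slipPhase a b q + k * (2 * Real.pi) < t)
    (h2 : t < Real.pi - slipPhase a b q + k * (2 * Real.pi)) : q < force a b t := by
  have hz := hA.slipPhase_mem
  have := sin_lt_sin_of_mem_Ioo (α := slipPhase a b q) (t := t - k * (2 * Real.pi))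
    ⟨by linarith, by linarith⟩ ⟨by linarith, by linarith⟩
  rw [Real.sin_sub_int_mul_two_pi] at this
  have := mul_lt_mul_of_pos_left this hA.ha
  unfold force
  linarith [hA.sin_slipPhase]

theorem force_lt (hA : Admissible a b q) {t : ℝ} (k : ℤ)
    (h1 : Real.pi - slipPhase a b q + k * (2 * Real.pi) < t)
    (h2 : t < 2 * Real.pi + slipPhase a b q + k * (2 * Real.pi)) : force a b t < q := by
  have hz := hA.slipPhase_mem
  have := sin_lt_sin_of_mem_Ioo' (α := slipPhase a b q) (t := t - k * (2 * Real.pi))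
    ⟨by linarith, by linarith⟩ ⟨by linarith, by linarith⟩
  rw [Real.sin_sub_int_mul_two_pi] at this
  have := mul_lt_mul_of_pos_left this hA.ha
  unfold force
  linarith [hA.sin_slipPhase]

theorem force_lt' (hA : Admissible a b q) {t : ℝ} (k : ℤ)
    (h1 : -zeroAngle a b + k * (2 * Real.pi) < t)
    (h2 : t < slipPhase a b q + k * (2 * Real.pi)) : force a b t < q := by
  have hz := hA.zeroAngle_mem
  have hz' := hA.slipPhase_mem
  -- This interval is the end of the low-force interval of the previous period.
  refine hA.force_lt (k - 1) ?_ ?_ <;> push_cast <;> linarith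

end Admissible

/-! ### Return to the delimiter and halt -/

/-- The free motion from rest at time `s` returns to the delimiter at time `θ`. -/
def IsReturn (a b s θ : ℝ) : Prop :=
  s < θ ∧ freeDisp a b s θ = 0 ∧ ∀ t ∈ Ioo s θ, freeDisp a b s t < 0

/-- Velocity at time `t` in the progression that follows a free motion on `[s, θ]` from rest. -/
noncomputable def haltVel (a b q s θ t : ℝ) : ℝ := freeVel a b s t - q * (t - θ)

/-- The progression that follows the free motion on `[s, θ]` ends at time `σ`. -/
def IsHalt (a b q s θ σ : ℝ) : Prop :=
  θ ≤ σ ∧ haltVel a b q s θ σ = 0 ∧ ∀ t ∈ Ico θ σ, 0 < haltVel a b q s θ t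

theorem hasDerivAt_haltVel (a b q s θ t : ℝ) :
    HasDerivAt (haltVel a b q s θ) (force a b t - q) t := by
  refine ((hasDerivAt_freeVel a b s t).sub
    (((hasDerivAt_id t).sub_const θ).const_mul q)).congr_deriv ?_
  simp

theorem continuous_haltVel (a b q s θ : ℝ) : Continuous (haltVel a b q s θ) :=
  continuous_iff_continuousAt.2 fun t => (hasDerivAt_haltVel a b q s θ t).continuousAt

theorem IsReturn.unique {a b s θ θ' : ℝ} (h : IsReturn a b s θ) (h' : IsReturn a b s θ') :
    θ = θ' := by
  rcases lt_trichotomy θ θ' with hlt | heq | hlt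
  · exact absurd h.2.1 (h'.2.2 θ ⟨h.1, hlt⟩).ne
  · exact heq
  · exact absurd h'.2.1 (h.2.2 θ' ⟨h'.1, hlt⟩).ne

theorem IsHalt.unique {a b q s θ σ σ' : ℝ} (h : IsHalt a b q s θ σ) (h' : IsHalt a b q s θ σ') :
    σ = σ' := by
  rcases lt_trichotomy σ σ' with hlt | heq | hlt
  · exact absurd h.2.1 (h'.2.2 σ ⟨h.1, hlt⟩).ne'
  · exact heq
  · exact absurd h'.2.1 (h.2.2 σ' ⟨h'.1, hlt⟩).ne'

theorem freeDisp_add_period (a b s t : ℝ) (k : ℤ) :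
    freeDisp a b (s + k * (2 * Real.pi)) (t + k * (2 * Real.pi)) = freeDisp a b s t := by
  simp only [freeDisp, Real.sin_add_int_mul_two_pi, Real.cos_add_int_mul_two_pi]
  ring

theorem freeVel_add_period (a b s t : ℝ) (k : ℤ) :
    freeVel a b (s + k * (2 * Real.pi)) (t + k * (2 * Real.pi)) = freeVel a b s t := by
  simp only [freeVel, Real.cos_add_int_mul_two_pi]
  ring

theorem IsReturn.add_period {a b s θ : ℝ} (h : IsReturn a b s θ) (k : ℤ) :
    IsReturn a b (s + k * (2 * Real.pi)) (θ + k * (2 * Real.pi)) := by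
  refine ⟨by linarith [h.1], by rw [freeDisp_add_period]; exact h.2.1, fun t ht => ?_⟩
  have := h.2.2 (t - k * (2 * Real.pi)) ⟨by linarith [ht.1], by linarith [ht.2]⟩
  rwa [← freeDisp_add_period a b _ _ k, sub_add_cancel] at this

theorem IsHalt.add_period {a b q s θ σ : ℝ} (h : IsHalt a b q s θ σ) (k : ℤ) :
    IsHalt a b q (s + k * (2 * Real.pi)) (θ + k * (2 * Real.pi)) (σ + k * (2 * Real.pi)) := by
  have key : ∀ t, haltVel a b q (s + k * (2 * Real.pi)) (θ + k * (2 * Real.pi))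
      (t + k * (2 * Real.pi)) = haltVel a b q s θ t := by
    intro t
    simp only [haltVel, freeVel_add_period]
    ring
  refine ⟨by linarith [h.1], by rw [key]; exact h.2.1, fun t ht => ?_⟩
  have := h.2.2 (t - k * (2 * Real.pi)) ⟨by linarith [ht.1], by linarith [ht.2]⟩
  rwa [← key, sub_add_cancel] at this

theorem exists_first_zero {f : ℝ → ℝ} {r M : ℝ} (hf : Continuous f) (hrM : r ≤ M) (hr : f r < 0)
    (hM : 0 ≤ f M) : ∃ θ ∈ Ioc r M, f θ = 0 ∧ ∀ t ∈ Ico r θ, f t < 0 := by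
  set S := {t | t ∈ Icc r M ∧ 0 ≤ f t} with hS
  have hcl : IsCompact S :=
    isCompact_Icc.inter_right (isClosed_le continuous_const hf)
  obtain ⟨θ, hθ⟩ := hcl.exists_isLeast ⟨M, ⟨hrM, le_rfl⟩, hM⟩
  have hlt : ∀ t ∈ Ico r θ, f t < 0 := by
    intro t ht
    by_contra hcon
    exact absurd (hθ.2 ⟨⟨ht.1, ht.2.le.trans hθ.1.1.2⟩, not_lt.1 hcon⟩) (not_le.2 ht.2)
  have hrθ : r < θ := hθ.1.1.1.lt_of_ne (by rintro rfl; exact absurd hθ.1.2 (not_le.2 hr))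
  refine ⟨θ, ⟨hrθ, hθ.1.1.2⟩, le_antisymm ?_ hθ.1.2, hlt⟩
  have h1 : Tendsto f (𝓝[<] θ) (𝓝 (f θ)) := hf.continuousAt.tendsto.mono_left nhdsWithin_le_nhds
  refine le_of_tendsto h1 ?_
  filter_upwards [Ioo_mem_nhdsLT hrθ] with t ht using (hlt t ⟨ht.1.le, ht.2⟩).le

theorem freeVel_neg_of_force_neg {a b s m t : ℝ} (hF : ∀ t ∈ Ioo s m, force a b t < 0)
    (ht : t ∈ Ioc s m) : freeVel a b s t < 0 := by
  have := lt_of_hasDerivAt_pos (f := fun t => -freeVel a b s t) (f' := fun t => -force a b t) ht.1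
    (continuous_freeVel a b s).neg.continuousOn (fun r _ => (hasDerivAt_freeVel a b s r).neg)
    (fun r hr => by linarith [hF r ⟨hr.1, hr.2.trans_le ht.2⟩])
  simpa using this

theorem freeDisp_neg_of_force_neg {a b s m t : ℝ} (hF : ∀ t ∈ Ioo s m, force a b t < 0)
    (ht : t ∈ Ioc s m) : freeDisp a b s t < 0 := by
  have := lt_of_hasDerivAt_pos (f := fun t => -freeDisp a b s t) (f' := fun t => -freeVel a b s t)
    ht.1 (continuous_freeDisp a b s).neg.continuousOn
    (fun r _ => (hasDerivAt_freeDisp a b s r).neg)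
    (fun r hr => by
      linarith [freeVel_neg_of_force_neg hF (t := r) ⟨hr.1, hr.2.le.trans ht.2⟩])
  simpa using this

/-- No free motion approaches the delimiter from the left with negative velocity. -/
theorem IsReturn.not_vel_neg {a b s θ w : ℝ} (h : IsReturn a b s θ) (hw : w < θ)
    (hv : ∀ t ∈ Ioo w θ, freeVel a b s t < 0) : False := by
  obtain ⟨r, hr⟩ := exists_between (max_lt hw h.1)
  have h1 := lt_of_hasDerivAt_pos (f := fun t => -freeDisp a b s t)
    (f' := fun t => -freeVel a b s t) hr.2 (continuous_freeDisp a b s).neg.continuousOn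
    (fun r _ => (hasDerivAt_freeDisp a b s r).neg)
    (fun t ht => by
      linarith [hv t ⟨(le_max_left _ _).trans_lt (hr.1.trans ht.1), ht.2⟩])
  have h2 := h.2.2 r ⟨(le_max_right _ _).trans_lt hr.1, hr.2⟩
  simp only [h.2.1] at h1
  linarith

theorem IsReturn.freeVel_nonneg {a b s θ : ℝ} (h : IsReturn a b s θ) : 0 ≤ freeVel a b s θ := by
  by_contra hneg
  push Not at hneg
  have h1 : ∀ᶠ t in 𝓝[<] θ, freeVel a b s t < 0 := nhdsWithin_le_nhds
    ((continuous_freeVel a b s).continuousAt.eventually (gt_mem_nhds hneg))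
  obtain ⟨w, hw, hw2⟩ := (mem_nhdsLT_iff_exists_Ioo_subset).1 h1
  exact h.not_vel_neg hw fun t ht => hw2 ht

/-- With F > q the velocity would increase to zero, hence be negative just before the halt. This
rules out halts at phases in (γ, π - γ), where progression would resume at once. -/
theorem IsHalt.force_le {a b q s θ σ : ℝ} (hq : 0 ≤ q) (hR : IsReturn a b s θ)
    (hH : IsHalt a b q s θ σ) : force a b σ ≤ q := by
  by_contra hlt
  push Not at hlt
  have h1 : ∀ᶠ t in 𝓝[<] σ, q < force a b t := nhdsWithin_le_nhds
    ((continuous_force a b).continuousAt.eventually (lt_mem_nhds hlt))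
  obtain ⟨w, hw, hw2⟩ := (mem_nhdsLT_iff_exists_Ioo_subset).1 h1
  have hmono : ∀ t ∈ Ioo w σ, haltVel a b q s θ t < haltVel a b q s θ σ := fun t ht =>
    lt_of_hasDerivAt_pos ht.2 (continuous_haltVel a b q s θ).continuousOn
      (fun r _ => hasDerivAt_haltVel a b q s θ r)
      (fun r hr => sub_pos.2 (hw2 ⟨ht.1.trans hr.1, hr.2⟩))
  rw [hH.2.1] at hmono
  rcases hH.1.eq_or_lt with rfl | hθσ
  -- For a halt at the return itself, t < θ makes the friction term non-negative, so the free
  -- velocity is negative before the return.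
  · refine hR.not_vel_neg hw fun t ht => ?_
    have := hmono t ht
    unfold haltVel at this
    nlinarith [ht.2]
  · obtain ⟨t, ht⟩ := exists_between (max_lt hw hθσ)
    have h2 := hmono t ⟨(le_max_left _ _).trans_lt ht.1, ht.2⟩
    have h3 := hH.2.2 t ⟨((le_max_right _ _).trans_lt ht.1).le, ht.2⟩
    linarith

namespace Admissible

variable {a b q : ℝ}

theorem freeDisp_neg (hA : Admissible a b q) {s t : ℝ} (k : ℤ)
    (hs : Real.pi + zeroAngle a b + k * (2 * Real.pi) ≤ s) (hst : s < t)
    (ht : t ≤ 2 * Real.pi - zeroAngle a b + k * (2 * Real.pi)) : freeDisp a b s t < 0 :=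
  freeDisp_neg_of_force_neg (m := 2 * Real.pi - zeroAngle a b + k * (2 * Real.pi))
    (fun _ hr => hA.force_neg k (hs.trans_lt hr.1) hr.2) ⟨hst, ht⟩

theorem exists_isReturn (hA : Admissible a b q) {s : ℝ} (k : ℤ)
    (hs : s ∈ Ico (Real.pi + zeroAngle a b + k * (2 * Real.pi))
      (2 * Real.pi - zeroAngle a b + k * (2 * Real.pi))) : ∃ θ, IsReturn a b s θ := by
  have ha := hA.ha
  have hb := hA.hb
  have hz := hA.zeroAngle_mem
  have hpi := Real.pi_pos
  -- With ℓ = a/b + 2 + π, b ℓ² is at least a ℓ + 2a, the greatest possible loss from the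
  -- trigonometric terms.
  obtain ⟨θ, hθ, h0, hlt⟩ := exists_first_zero (f := freeDisp a b s)
    (r := 2 * Real.pi - zeroAngle a b + k * (2 * Real.pi)) (M := s + (a / b + 2 + Real.pi))
    (continuous_freeDisp a b s) (by have : 0 < a / b := by positivity
                                    linarith [hs.1])
    (hA.freeDisp_neg k hs.1 hs.2 le_rfl) (by
      have h1 : b * (a / b + 2 + Real.pi) = a + b * (2 + Real.pi) := by field_simp; ring
      have h2 : 0 < a / b := by positivity
      have h3 : b * (a / b) = a := by field_simp
      have h4 := Real.sin_le_one (s + (a / b + 2 + Real.pi))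
      have h5 := Real.neg_one_le_sin s
      have h6 := Real.neg_one_le_cos s
      unfold freeDisp
      set ℓ := a / b + 2 + Real.pi
      have h7 : a / b ≤ ℓ := by simp only [ℓ]; linarith
      have e1 : s + ℓ - s = ℓ := by ring
      rw [e1]
      have h8 : 0 ≤ a * (Real.sin s + 1 + (1 - Real.sin (s + ℓ)) + ℓ * (Real.cos s + 1)) :=
        mul_nonneg ha.le (by nlinarith)
      have h9 : b * ℓ ^ 2 = ℓ * (a + b * (2 + Real.pi)) := by rw [← h1]; ring
      have h10 : a / b * (b * (2 + Real.pi)) ≤ ℓ * (b * (2 + Real.pi)) :=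
        mul_le_mul_of_nonneg_right h7 (by positivity)
      have h11 : a / b * (b * (2 + Real.pi)) = a * (2 + Real.pi) := by field_simp
      nlinarith)
  refine ⟨θ, hs.2.trans hθ.1, h0, fun t ht => ?_⟩
  rcases le_or_gt (2 * Real.pi - zeroAngle a b + k * (2 * Real.pi)) t with h | h
  · exact hlt t ⟨h, ht.2⟩
  · exact hA.freeDisp_neg k hs.1 ht.1 h.le

theorem exists_isHalt (hA : Admissible a b q) {s θ : ℝ} (hR : IsReturn a b s θ) :
    ∃ σ, IsHalt a b q s θ σ := by
  have hV := hR.freeVel_nonneg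
  have h0 : haltVel a b q s θ θ = freeVel a b s θ := by simp [haltVel]
  rcases hV.eq_or_lt with hV | hV
  · exact ⟨θ, le_rfl, by rw [h0, ← hV], fun t ht => absurd ht.1 (not_le.2 ht.2)⟩
  have hq : 0 < q - 2 * b := by linarith [hA.hbq]
  have ha := hA.ha
  -- In a time ℓ the velocity grows by at most 2a - (q - 2b) ℓ, which gives the value of ℓ.
  obtain ⟨σ, hσ, h1, h2⟩ := exists_first_zero (f := fun t => -haltVel a b q s θ t) (r := θ)
    (M := θ + (freeVel a b s θ + 2 * a) / (q - 2 * b)) (continuous_haltVel a b q s θ).neg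
    (by have : 0 < (freeVel a b s θ + 2 * a) / (q - 2 * b) := by positivity
        linarith) (by rw [h0]; linarith) (by
      have e1 : (q - 2 * b) * ((freeVel a b s θ + 2 * a) / (q - 2 * b)) =
        freeVel a b s θ + 2 * a := by field_simp
      set ℓ := (freeVel a b s θ + 2 * a) / (q - 2 * b)
      have h3 := Real.cos_le_one θ
      have h4 := Real.neg_one_le_cos (θ + ℓ)
      rw [haltVel, ← freeVel_add a b s θ]
      have h5 : freeVel a b θ (θ + ℓ) = a * (Real.cos θ - Real.cos (θ + ℓ)) + 2 * b * ℓ := by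
        unfold freeVel; ring
      rw [h5]
      nlinarith)
  exact ⟨σ, hσ.1.le, by simpa using h1, fun t ht => by simpa using h2 t ht⟩

/-- A slip that starts from rest when the force exceeds the friction ends before the force
becomes negative. -/
theorem exists_slip (hA : Admissible a b q) (k : ℤ) :
    ∃ σ ∈ Ioo (Real.pi - slipPhase a b q + k * (2 * Real.pi))
        (Real.pi + zeroAngle a b + k * (2 * Real.pi)),
      haltVel a b q (slipPhase a b q + k * (2 * Real.pi)) (slipPhase a b q + k * (2 * Real.pi)) σ
        = 0 ∧
      ∀ t ∈ Ioo (slipPhase a b q + k * (2 * Real.pi)) σ, 0 < haltVel a b q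
        (slipPhase a b q + k * (2 * Real.pi)) (slipPhase a b q + k * (2 * Real.pi)) t := by
  have hz := hA.slipPhase_mem
  have hz' := hA.zeroAngle_mem
  set r := slipPhase a b q + k * (2 * Real.pi) with hr
  set m := Real.pi - slipPhase a b q + k * (2 * Real.pi) with hm
  have h0 : haltVel a b q r r r = 0 := by simp [haltVel]
  have hpos : ∀ t ∈ Ioc r m, 0 < haltVel a b q r r t := by
    intro t ht
    rw [← h0]
    exact lt_of_hasDerivAt_pos ht.1 (continuous_haltVel a b q r r).continuousOn
      (fun u _ => hasDerivAt_haltVel a b q r r u)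
      (fun u hu => sub_pos.2 (hA.lt_force k hu.1 (hu.2.trans_le ht.2)))
  have hrm : r < m := by simp only [hr, hm]; linarith
  have hneg : haltVel a b q r r (Real.pi + zeroAngle a b + k * (2 * Real.pi)) < 0 := by
    rw [hr, haltVel, freeVel_add_period, freeVel, add_comm Real.pi, Real.cos_add_pi]
    linarith [hA.hslip]
  obtain ⟨σ, hσ, h1, h2⟩ := exists_first_zero (f := fun t => -haltVel a b q r r t) (r := m)
    (M := Real.pi + zeroAngle a b + k * (2 * Real.pi)) (continuous_haltVel a b q r r).neg
    (by linarith) (by linarith [hpos m ⟨hrm, le_rfl⟩]) (by linarith)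
  have h3 : haltVel a b q r r σ = 0 := by simpa using h1
  refine ⟨σ, ⟨hσ.1, hσ.2.lt_of_ne ?_⟩, h3, fun t ht => ?_⟩
  · rintro rfl
    linarith
  · rcases le_or_gt t m with h | h
    · exact hpos t ⟨ht.1, h⟩
    · have := h2 t ⟨h.le, ht.2⟩
      linarith

end Admissible

/-! ### From the halt to the next transition -/

section

variable {a b q s e : ℝ} {x v y : ℝ → ℝ}

/-- Three cases for the rest phase u: beyond π + β nothing happens; from π - γ on, the force stays
in (0, q) until π + β; for u ≤ γ the mass stops until γ, slips, and stops again until π + β. The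
hypothesis F ≤ q excludes the remaining phases. -/
theorem IsMotion.contact_until (h : IsMotion a b q s e x v y) (hA : Admissible a b q)
    {u : ℝ} (k : ℤ) (hu : u ∈ Ico (-zeroAngle a b) (2 * Real.pi - zeroAngle a b))
    (hs : s ≤ u + k * (2 * Real.pi)) (hF : force a b (u + k * (2 * Real.pi)) ≤ q)
    (he : max u (Real.pi + zeroAngle a b) + k * (2 * Real.pi) ≤ e)
    (hxy : x (u + k * (2 * Real.pi)) = y (u + k * (2 * Real.pi)))
    (hv : v (u + k * (2 * Real.pi)) = 0) :
    (∀ t ∈ Icc (u + k * (2 * Real.pi)) (max u (Real.pi + zeroAngle a b) + k * (2 * Real.pi)),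
      x t = y t) ∧ v (max u (Real.pi + zeroAngle a b) + k * (2 * Real.pi)) = 0 := by
  have hz := hA.zeroAngle_mem
  have hz' := hA.slipPhase_mem
  have hq : 0 ≤ q := by linarith [hA.hb, hA.hbq]
  rcases le_or_gt (Real.pi + zeroAngle a b) u with h1 | h1
  · rw [max_eq_left h1]
    refine ⟨fun t ht => ?_, hv⟩
    rw [Icc_self, mem_singleton_iff] at ht
    rw [ht, hxy]
  rw [max_eq_right h1.le] at he ⊢
  rcases le_or_gt (Real.pi - slipPhase a b q) u with h2 | h2
  · have key := fun t => h.stay_stopped (r := u + k * (2 * Real.pi)) (t := t) hs he hxy hv fun t ht =>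
      ⟨hA.force_pos k (by linarith [ht.1]) ht.2,
        hA.force_lt k (by linarith [ht.1]) (by linarith [ht.2])⟩
    exact ⟨fun t ht => (key t ht).1, (key _ (right_mem_Icc.2 (by linarith))).2⟩
  have h3 : u ≤ slipPhase a b q := by
    by_contra hlt
    push Not at hlt
    linarith [hA.lt_force (t := u + k * (2 * Real.pi)) k (by linarith) (by linarith)]
  obtain ⟨σ, hσ, hW0, hW⟩ := hA.exists_slip k
  set r := slipPhase a b q + k * (2 * Real.pi) with hr
  have hur : u + k * (2 * Real.pi) ≤ r := by linarith
  have hrσ : r < σ := by linarith [hσ.1]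
  have key1 := fun t => h.stay_stopped (r := u + k * (2 * Real.pi)) (m := r) (t := t) hs
    (by linarith [hσ.2]) hxy hv fun t ht =>
      ⟨hA.force_pos k (by linarith [ht.1, hu.1]) (by linarith [ht.2]),
        hA.force_lt' k (by linarith [ht.1, hu.1]) ht.2⟩
  have hr0 := key1 r (right_mem_Icc.2 hur)
  have hrse : r ∈ Ico s e := ⟨hs.trans hur, by linarith [hσ.2]⟩
  have key2 := fun t => h.progression (r := r) (m := σ) (t := t) hrse.1 (by linarith [hσ.2]) hr0.1
    (fun _ => h.exists_progressionOn_of_lt_force hq hrse hr0.1 hr0.2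
      (m := Real.pi - slipPhase a b q + k * (2 * Real.pi)) (by linarith)
      fun t ht => hA.lt_force k ht.1 ht.2)
    (fun t ht => by rw [hr0.2, zero_add]; exact hW t ht)
  have hσ0 : v σ = 0 := by
    rw [(key2 σ (right_mem_Icc.2 hrσ.le)).2, hr0.2, zero_add]
    exact hW0
  have key3 := fun t => h.stay_stopped (r := σ) (t := t) (hrse.1.trans hrσ.le) he
    (key2 σ (right_mem_Icc.2 hrσ.le)).1 hσ0 fun t ht =>
      ⟨hA.force_pos k (by linarith [ht.1, hσ.1]) ht.2,
        hA.force_lt k (by linarith [ht.1, hσ.1]) (by linarith [ht.2])⟩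
  refine ⟨fun t ht => ?_, (key3 _ (right_mem_Icc.2 hσ.2.le)).2⟩
  rcases le_total t r with h4 | h4
  · exact (key1 t ⟨ht.1, h4⟩).1
  · rcases le_total t σ with h5 | h5
    · exact (key2 t ⟨h4, h5⟩).1
    · exact (key3 t ⟨h5, ht.2⟩).1

theorem IsMotion.isFirstToFreeAfter (h : IsMotion a b q s e x v y) (hA : Admissible a b q)
    (hfree : ToFree x v y s) {θ u : ℝ} (k : ℤ) (hR : IsReturn a b s θ)
    (hH : IsHalt a b q s θ (u + k * (2 * Real.pi)))
    (hu : u ∈ Ico (-zeroAngle a b) (2 * Real.pi - zeroAngle a b))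
    (he : max u (Real.pi + zeroAngle a b) + k * (2 * Real.pi) < e) :
    IsFirstToFreeAfter x v y s (max u (Real.pi + zeroAngle a b) + k * (2 * Real.pi)) := by
  have hz := hA.zeroAngle_mem
  have hq : 0 ≤ q := by linarith [hA.hb, hA.hbq]
  have hF := hH.force_le hq hR
  set σ := u + k * (2 * Real.pi) with hσ
  set τ := max u (Real.pi + zeroAngle a b) + k * (2 * Real.pi) with hτ
  have hστ : σ ≤ τ := by simp only [hσ, hτ]; linarith [le_max_left u (Real.pi + zeroAngle a b)]
  have hθσ := hH.1
  have hsθ := hR.1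
  have key1 := fun t => h.free_flight (r := s) (m := θ) (t := t) le_rfl (by linarith) hfree hR.2.2
  obtain ⟨hvθ, hxθ, hyθ⟩ := key1 θ (right_mem_Icc.2 hsθ.le)
  have hxyθ : x θ = y θ := by rw [hxθ, hyθ, hR.2.1, add_zero]
  have hWeq : ∀ t, v θ + freeVel a b θ t - q * (t - θ) = haltVel a b q s θ t := fun t => by
    rw [hvθ, freeVel_add, haltVel]
  have key2 := fun t => h.progression (r := θ) (m := σ) (t := t) hsθ.le (by linarith) hxyθ
    (fun hlt => h.exists_progressionOn_of_vel_pos ⟨hsθ.le, by linarith⟩ hxyθ (by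
      have := hH.2.2 θ ⟨le_rfl, hlt⟩
      rw [← hWeq] at this
      simpa using this))
    (fun t ht => by rw [hWeq]; exact hH.2.2 t ⟨ht.1.le, ht.2⟩)
  simp only [hWeq] at key2
  obtain ⟨hxyσ, hvσ⟩ := key2 σ (right_mem_Icc.2 hθσ)
  rw [hH.2.1] at hvσ
  obtain ⟨hc, hvτ⟩ := h.contact_until hA k hu (by linarith) hF he.le hxyσ hvσ
  refine ⟨by linarith, ?_, fun t ht hcon => ?_⟩
  · refine h.toFree_of_force_neg hq ⟨by linarith, he⟩ (hc τ (right_mem_Icc.2 hστ)) hvτ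
      (m := 2 * Real.pi - zeroAngle a b + k * (2 * Real.pi)) ?_ fun t ht => hA.force_neg k ?_ ht.2
    · simp only [hτ]
      have : max u (Real.pi + zeroAngle a b) < 2 * Real.pi - zeroAngle a b :=
        max_lt hu.2 (by linarith)
      linarith
    · have := ht.1
      simp only [hτ] at this
      linarith [le_max_right u (Real.pi + zeroAngle a b)]
  -- No earlier transition: contact fails in flight, the velocity is positive in progression, and
  -- afterwards contact persists.
  · rcases lt_or_ge t θ with h1 | h1
    · have h2 := key1 t ⟨ht.1.le, h1.le⟩
      have h3 := hR.2.2 t ⟨ht.1, h1⟩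
      have h4 := hcon.1
      linarith
    · rcases lt_or_ge t σ with h2 | h2
      · have h3 := (key2 t ⟨h1, h2.le⟩).2
        have h4 := hH.2.2 t ⟨h1, h2⟩
        have h5 := hcon.2.1
        linarith
      · obtain ⟨w, hw1, hw2⟩ := (hcon.2.2.and (Ioo_mem_nhdsGT ht.2)).exists
        exact hw1.ne (hc w ⟨h2.trans hw2.1.le, hw2.2.le⟩)

/-- The existence counterpart: the same three cases, with the stop and slip pieces glued on. -/
theorem ReachesContact.contact_until (hA : Admissible a b q) {u : ℝ} (k : ℤ)
    (h : ReachesContact a b q s (u + k * (2 * Real.pi)) 0)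
    (hu : u ∈ Ico (-zeroAngle a b) (2 * Real.pi - zeroAngle a b))
    (hF : force a b (u + k * (2 * Real.pi)) ≤ q) :
    ReachesContact a b q s (max u (Real.pi + zeroAngle a b) + k * (2 * Real.pi)) 0 := by
  have hz := hA.zeroAngle_mem
  have hz' := hA.slipPhase_mem
  rcases le_or_gt (Real.pi + zeroAngle a b) u with h1 | h1
  · rwa [max_eq_left h1]
  rw [max_eq_right h1.le]
  rcases le_or_gt (Real.pi - slipPhase a b q) u with h2 | h2
  · exact h.stay_stopped (by linarith) fun t ht =>
      ⟨hA.force_pos k (by linarith [ht.1]) ht.2,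
        hA.force_lt k (by linarith [ht.1]) (by linarith [ht.2])⟩
  have h3 : u ≤ slipPhase a b q := by
    by_contra hlt
    push Not at hlt
    linarith [hA.lt_force (t := u + k * (2 * Real.pi)) k (by linarith) (by linarith)]
  obtain ⟨σ, hσ, hW0, hW⟩ := hA.exists_slip k
  have key1 := h.stay_stopped (e := slipPhase a b q + k * (2 * Real.pi)) (by linarith) fun t ht =>
      ⟨hA.force_pos k (by linarith [ht.1, hu.1]) (by linarith [ht.2]),
        hA.force_lt' k (by linarith [ht.1, hu.1]) ht.2⟩
  have key2 := key1.progression (e := σ) (by linarith [hσ.1]) fun t ht => by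
    rw [zero_add]
    exact hW t ht
  rw [zero_add] at key2
  unfold haltVel at hW0
  rw [hW0] at key2
  exact key2.stay_stopped hσ.2.le fun t ht =>
      ⟨hA.force_pos k (by linarith [ht.1, hσ.1]) ht.2,
        hA.force_lt k (by linarith [ht.1, hσ.1]) (by linarith [ht.2])⟩

theorem exists_motion_beyond (hA : Admissible a b q) {θ u : ℝ} (k : ℤ) (hR : IsReturn a b s θ)
    (hH : IsHalt a b q s θ (u + k * (2 * Real.pi)))
    (hu : u ∈ Ico (-zeroAngle a b) (2 * Real.pi - zeroAngle a b)) :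
    ∃ (e : ℝ) (x v y : ℝ → ℝ), max u (Real.pi + zeroAngle a b) + k * (2 * Real.pi) < e ∧
      IsMotion a b q s e x v y ∧ ToFree x v y s := by
  have hz := hA.zeroAngle_mem
  have hq : 0 ≤ q := by linarith [hA.hb, hA.hbq]
  have hWeq : ∀ t, freeVel a b s θ + freeVel a b θ t - q * (t - θ) = haltVel a b q s θ t :=
    fun t => by rw [freeVel_add, haltVel]
  have h1 : ReachesContact a b q s θ (freeVel a b s θ) :=
    ReachesContact.of_free hR.1 hR.2.2 hR.2.1
  have h2 := h1.progression hH.1 fun t ht => by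
    rw [hWeq]
    exact hH.2.2 t ⟨ht.1.le, ht.2⟩
  rw [hWeq, hH.2.1] at h2
  have h3 := h2.contact_until hA k hu (hH.force_le hq hR)
  have h4 : max u (Real.pi + zeroAngle a b) < 2 * Real.pi - zeroAngle a b :=
    max_lt hu.2 (by linarith)
  have h5 := le_max_right u (Real.pi + zeroAngle a b)
  have h6 : max u (Real.pi + zeroAngle a b) + k * (2 * Real.pi) <
      2 * Real.pi - zeroAngle a b + k * (2 * Real.pi) := by linarith
  -- A last free piece up to 2π - β makes the motion last strictly beyond the transition.
  obtain ⟨x, v, y, hM, hT⟩ := h3.exists_motion_beyond h6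
    (fun t ht => hA.freeDisp_neg k (by linarith) ht.1 ht.2.le)
    (hA.freeDisp_neg k (by linarith) h6 le_rfl).le
  exact ⟨_, x, v, y, h6, hM, hT⟩

end

/-! ### The switching-phase map -/

/-- `z` is the phase of the transition that follows a transition at phase `p`. -/
def IsNextPhase (a b q p z : ℝ) : Prop :=
  -- With u taken in [-β, 2π - β), a halt below π + β waits for π + β and a later halt is itself the
  -- transition, hence the maximum.
  ∃ (θ u : ℝ) (k : ℤ), IsReturn a b p θ ∧ IsHalt a b q p θ (u + k * (2 * Real.pi)) ∧
    u ∈ Ico (-zeroAngle a b) (2 * Real.pi - zeroAngle a b) ∧ z = max u (Real.pi + zeroAngle a b)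

open Classical in
/-- The switching-phase map. -/
noncomputable def switchMap (a b q p : ℝ) : ℝ :=
  -- The default 0 is never used on [t₂, t₃), by `Admissible.exists_next`.
  if h : ∃ z, IsNextPhase a b q p z then h.choose else 0

theorem exists_add_int_mul_two_pi (c t : ℝ) :
    ∃ (u : ℝ) (k : ℤ), u ∈ Ico c (c + 2 * Real.pi) ∧ t = u + k * (2 * Real.pi) := by
  refine ⟨toIcoMod Real.two_pi_pos c t, toIcoDiv Real.two_pi_pos c t,
    toIcoMod_mem_Ico Real.two_pi_pos c t, ?_⟩
  have := toIcoMod_add_toIcoDiv_zsmul Real.two_pi_pos c t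
  rw [zsmul_eq_mul] at this
  exact this.symm

theorem add_int_mul_two_pi_inj {c u u' : ℝ} {k k' : ℤ} (hu : u ∈ Ico c (c + 2 * Real.pi))
    (hu' : u' ∈ Ico c (c + 2 * Real.pi)) (h : u + k * (2 * Real.pi) = u' + k' * (2 * Real.pi)) :
    u = u' := by
  have h1 : toIcoMod Real.two_pi_pos c (u + k * (2 * Real.pi)) = u := by
    rw [← zsmul_eq_mul, toIcoMod_add_zsmul]
    exact (toIcoMod_eq_self Real.two_pi_pos).2 hu
  have h2 : toIcoMod Real.two_pi_pos c (u' + k' * (2 * Real.pi)) = u' := by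
    rw [← zsmul_eq_mul, toIcoMod_add_zsmul]
    exact (toIcoMod_eq_self Real.two_pi_pos).2 hu'
  rw [← h1, ← h2, h]

theorem phase_add_int_mul_two_pi {u : ℝ} (k : ℤ) (hu : u ∈ Ico 0 (2 * Real.pi)) :
    phase (u + k * (2 * Real.pi)) = u := by
  rw [phase, ← zsmul_eq_mul, toIcoMod_add_zsmul]
  exact (toIcoMod_eq_self Real.two_pi_pos).2 (by simpa using hu)

theorem IsNextPhase.unique {a b q p z z' : ℝ} (h : IsNextPhase a b q p z)
    (h' : IsNextPhase a b q p z') : z = z' := by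
  obtain ⟨θ, u, k, hR, hH, hu, rfl⟩ := h
  obtain ⟨θ', u', k', hR', hH', hu', rfl⟩ := h'
  obtain rfl := hR.unique hR'
  have : u = u' := add_int_mul_two_pi_inj (c := -zeroAngle a b) (k := k) (k' := k')
    ⟨hu.1, by linarith [hu.2]⟩ ⟨hu'.1, by linarith [hu'.2]⟩ (hH.unique hH')
  rw [this]

theorem IsNextPhase.switchMap_eq {a b q p z : ℝ} (h : IsNextPhase a b q p z) :
    switchMap a b q p = z := by
  have hex : ∃ z, IsNextPhase a b q p z := ⟨z, h⟩
  rw [switchMap, dif_pos hex]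
  exact hex.choose_spec.unique h

namespace Admissible

variable {a b q : ℝ}

theorem exists_next (hA : Admissible a b q) {s : ℝ} (k : ℤ)
    (hs : s ∈ Ico (Real.pi + zeroAngle a b + k * (2 * Real.pi))
      (2 * Real.pi - zeroAngle a b + k * (2 * Real.pi))) :
    ∃ (θ u : ℝ) (k : ℤ), IsReturn a b s θ ∧ IsHalt a b q s θ (u + k * (2 * Real.pi)) ∧
      u ∈ Ico (-zeroAngle a b) (2 * Real.pi - zeroAngle a b) := by
  obtain ⟨θ, hR⟩ := hA.exists_isReturn k hs
  obtain ⟨σ, hH⟩ := hA.exists_isHalt hR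
  obtain ⟨u, j, hu, rfl⟩ := exists_add_int_mul_two_pi (-zeroAngle a b) σ
  exact ⟨θ, u, j, hR, hH, hu.1, by linarith [hu.2]⟩

/-- Right after a phase in [-β, π + β) the force is positive and presses the mass against the
delimiter. -/
theorem mem_of_toFree (hA : Admissible a b q) {s e : ℝ} {x v y : ℝ → ℝ} (hse : s < e)
    (h : IsMotion a b q s e x v y) (hT : ToFree x v y s) :
    phase s ∈ Ico (phase2 a b) (phase3 a b) := by
  have hz := hA.zeroAngle_mem
  obtain ⟨u, k, hu, rfl⟩ := exists_add_int_mul_two_pi (-zeroAngle a b) s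
  rcases lt_or_ge u (Real.pi + zeroAngle a b) with h1 | h1
  · exfalso
    obtain ⟨t', ht', hf⟩ := h.exists_freeOn_of_eventually_lt (left_mem_Ico.2 hse) hT.2.2
    have hm : u + k * (2 * Real.pi) < min t' (Real.pi + zeroAngle a b + k * (2 * Real.pi)) :=
      lt_min ht'.1 (by linarith)
    refine h.not_freeOn_of_force_pos le_rfl ((min_le_left _ _).trans ht'.2) hm hT.1 hT.2.1
      (fun t ht => hA.force_pos k (by linarith [ht.1, hu.1]) (ht.2.trans_le (min_le_right _ _)))
      (hf.mono le_rfl (min_le_left _ _))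
  · rw [phase_add_int_mul_two_pi k ⟨by linarith, by linarith [hu.2]⟩]
    exact ⟨h1, by have := hu.2; simp only [phase3]; unfold zeroAngle at this; linarith⟩

theorem switchMap_mem (hA : Admissible a b q) {p : ℝ} (hp : p ∈ Ico (phase2 a b) (phase3 a b)) :
    switchMap a b q p ∈ Ico (phase2 a b) (phase3 a b) := by
  have hz := hA.zeroAngle_mem
  obtain ⟨θ, u, k, hR, hH, hu⟩ := hA.exists_next (s := p) 0
    (by simpa [phase2, phase3, zeroAngle] using hp)
  have hN : IsNextPhase a b q p _ := ⟨θ, u, k, hR, hH, hu, rfl⟩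
  rw [hN.switchMap_eq]
  exact ⟨le_max_right _ _, (max_lt hu.2 (by linarith) : _ < 2 * Real.pi - zeroAngle a b)⟩

theorem isSwitchingPhaseMap (hA : Admissible a b q) :
    IsSwitchingPhaseMap a b q (switchMap a b q) := by
  have hz := hA.zeroAngle_mem
  refine ⟨fun s e x v y hse h hT => hA.mem_of_toFree hse h hT, fun s hs => ?_⟩
  obtain ⟨p, j, hp, rfl⟩ := exists_add_int_mul_two_pi 0 s
  rw [zero_add] at hp
  rw [phase_add_int_mul_two_pi j hp] at hs ⊢
  obtain ⟨θ, u, k, hR, hH, hu⟩ := hA.exists_next (s := p) 0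
    (by simpa [phase2, phase3, zeroAngle] using hs)
  have hN : IsNextPhase a b q p _ := ⟨θ, u, k, hR, hH, hu, rfl⟩
  -- Return and halt computed at the phase p are carried to the actual time by j periods of the
  -- force.
  have hR' := hR.add_period j
  have hH' := hH.add_period j
  have e1 : ∀ w : ℝ, w + k * (2 * Real.pi) + j * (2 * Real.pi) =
      w + ((k + j : ℤ) : ℝ) * (2 * Real.pi) := by intro w; push_cast; ring
  rw [e1] at hH'
  refine ⟨max u (Real.pi + zeroAngle a b) + ((k + j : ℤ) : ℝ) * (2 * Real.pi), ?_, ?_, ?_⟩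
  · obtain ⟨e, x, v, y, he, hM, hT⟩ := exists_motion_beyond hA (k + j) hR' hH' hu
    exact ⟨e, x, v, y, he, hM, hT, hM.isFirstToFreeAfter hA hT (k + j) hR' hH' hu he⟩
  · exact fun e x v y he hM hT => hM.isFirstToFreeAfter hA hT (k + j) hR' hH' hu he
  · rw [hN.switchMap_eq, phase_add_int_mul_two_pi]
    exact ⟨(by linarith : (0 : ℝ) ≤ Real.pi + zeroAngle a b).trans (le_max_right _ _),
      (max_lt hu.2 (by linarith)).trans (by linarith)⟩

end Admissible

/-! ### Horseshoes on the line -/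

/-- Take d as the first point with value f w and c as the last point before d with value f r. A
value outside [f r, f w] in between would, by intermediate values, contradict one of these choices.
-/
theorem exists_Icc_image_eq_of_le {f : ℝ → ℝ} {r w : ℝ} (hrw : r ≤ w)
    (hf : ContinuousOn f (Icc r w)) (hle : f r ≤ f w) :
    ∃ c d, c ≤ d ∧ Icc c d ⊆ Icc r w ∧ f '' Icc c d = Icc (f r) (f w) := by
  have hcl : ∀ {r' w' : ℝ} (z : ℝ), Icc r' w' ⊆ Icc r w →
      IsCompact (Icc r' w' ∩ f ⁻¹' {z}) := fun z hsub =>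
    isCompact_Icc.of_isClosed_subset
      ((hf.mono hsub).preimage_isClosed_of_isClosed isClosed_Icc isClosed_singleton)
      inter_subset_left
  obtain ⟨d, hd⟩ := (hcl (f w) (le_refl (Icc r w))).exists_isLeast ⟨w, ⟨hrw, le_rfl⟩, rfl⟩
  have hsub1 : Icc r d ⊆ Icc r w := Icc_subset_Icc_right hd.1.1.2
  obtain ⟨c, hc⟩ := (hcl (f r) hsub1).exists_isGreatest ⟨r, ⟨le_rfl, hd.1.1.1⟩, rfl⟩
  have hfd : f d = f w := hd.1.2
  have hfc : f c = f r := hc.1.2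
  have hsub2 : Icc c d ⊆ Icc r w := Icc_subset_Icc hc.1.1.1 hd.1.1.2
  refine ⟨c, d, hc.1.1.2, hsub2, Subset.antisymm ?_ ?_⟩
  · rintro _ ⟨t, ht, rfl⟩
    have htr : r ≤ t := hc.1.1.1.trans ht.1
    constructor
    · by_contra hlt
      push Not at hlt
      obtain ⟨t', ht', he⟩ := intermediate_value_Icc ht.2
        (hf.mono (Icc_subset_Icc htr hd.1.1.2)) ⟨hlt.le, hfd ▸ hle⟩
      have h1 := hc.2 ⟨⟨htr.trans ht'.1, ht'.2⟩, he⟩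
      have : t = c := le_antisymm (ht'.1.trans h1) ht.1
      rw [this, hfc] at hlt
      exact lt_irrefl _ hlt
    · by_contra hlt
      push Not at hlt
      obtain ⟨t', ht', he⟩ := intermediate_value_Icc htr
        (hf.mono (Icc_subset_Icc_right (ht.2.trans hd.1.1.2))) ⟨hle, hlt.le⟩
      have h1 := hd.2 ⟨⟨ht'.1, ht'.2.trans (ht.2.trans hd.1.1.2)⟩, he⟩
      have : t = d := le_antisymm ht.2 (h1.trans ht'.2)
      rw [this, hfd] at hlt
      exact lt_irrefl _ hlt
  · rw [← hfc, ← hfd]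
    exact intermediate_value_Icc hc.1.1.2 (hf.mono hsub2)

theorem exists_Icc_image_eq {f : ℝ → ℝ} {c d α β : ℝ} (hf : ContinuousOn f (Icc c d))
    (hαβ : α ≤ β) (hsub : Icc α β ⊆ f '' Icc c d) :
    ∃ c' d', c' ≤ d' ∧ Icc c' d' ⊆ Icc c d ∧ f '' Icc c' d' = Icc α β := by
  obtain ⟨r, hr, rfl⟩ := hsub (left_mem_Icc.2 hαβ)
  obtain ⟨w, hw, rfl⟩ := hsub (right_mem_Icc.2 hαβ)
  rcases le_total r w with h | h
  · obtain ⟨c', d', h1, h2, h3⟩ := exists_Icc_image_eq_of_le h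
      (hf.mono (Icc_subset_Icc hr.1 hw.2)) hαβ
    exact ⟨c', d', h1, h2.trans (Icc_subset_Icc hr.1 hw.2), h3⟩
  · obtain ⟨c', d', h1, h2, h3⟩ := exists_Icc_image_eq_of_le (f := fun t => -f t) h
      (hf.mono (Icc_subset_Icc hw.1 hr.2)).neg (neg_le_neg hαβ)
    refine ⟨c', d', h1, h2.trans (Icc_subset_Icc hw.1 hr.2), ?_⟩
    have h4 : f '' Icc c' d' = Neg.neg '' ((fun t => -f t) '' Icc c' d') := by
      rw [image_image]
      simp
    rw [h4, h3]
    simp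

/-- Two disjoint segments in `[A, B]`, each of which `T` maps continuously over `[A, B]`. -/
structure Horseshoe (T : ℝ → ℝ) (A B : ℝ) (c d : Bool → ℝ) : Prop where
  lt : ∀ i, c i < d i
  subset : ∀ i, Icc (c i) (d i) ⊆ Icc A B
  disjoint : Disjoint (Icc (c false) (d false)) (Icc (c true) (d true))
  continuousOn : ∀ i, ContinuousOn T (Icc (c i) (d i))
  covers : ∀ i, Icc A B ⊆ T '' Icc (c i) (d i)

namespace Horseshoe

variable {T : ℝ → ℝ} {A B : ℝ} {c d : Bool → ℝ}

/-- Induction by pulling back: the segment for the shifted word is the exact image of a subsegment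
of the one for the first symbol. -/
theorem exists_segment (h : Horseshoe T A B c d) (n : ℕ) (ω : ℕ → Bool) :
    ∃ r w, r ≤ w ∧ (∀ p ∈ Icc r w, ∀ k ≤ n, T^[k] p ∈ Icc (c (ω k)) (d (ω k))) ∧
      ContinuousOn T^[n + 1] (Icc r w) ∧ Icc A B ⊆ T^[n + 1] '' Icc r w := by
  induction n generalizing ω with
  | zero =>
    refine ⟨c (ω 0), d (ω 0), (h.lt _).le, fun p hp k hk => ?_, h.continuousOn _, h.covers _⟩
    obtain rfl : k = 0 := by omega
    exact hp
  | succ n ih =>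
    obtain ⟨r, w, hrw, h1, h2, h3⟩ := ih fun k => ω (k + 1)
    have hsub : Icc r w ⊆ Icc A B := fun p hp => h.subset _ (h1 p hp 0 (Nat.zero_le _))
    obtain ⟨r', w', hrw', h4, h5⟩ :=
      exists_Icc_image_eq (h.continuousOn (ω 0)) hrw (hsub.trans (h.covers (ω 0)))
    refine ⟨r', w', hrw', fun p hp k hk => ?_, ?_, ?_⟩
    · cases k with
      | zero => exact h4 hp
      | succ k => exact h1 (T p) (h5 ▸ mem_image_of_mem T hp) k (by omega)
    · rw [Function.iterate_succ]
      exact h2.comp ((h.continuousOn _).mono h4) (h5 ▸ mapsTo_image T _)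
    · rw [Function.iterate_succ, image_comp, h5]
      exact h3

/-- The image of the segment under the iterate covers the segment itself, so the difference with the
identity vanishes somewhere. -/
theorem exists_fixed (h : Horseshoe T A B c d) (n : ℕ) (ω : ℕ → Bool) :
    ∃ p, T^[n + 1] p = p ∧ ∀ k ≤ n, T^[k] p ∈ Icc (c (ω k)) (d (ω k)) := by
  obtain ⟨r, w, hrw, h1, h2, h3⟩ := h.exists_segment n ω
  have hsub : Icc r w ⊆ Icc A B := fun p hp => h.subset _ (h1 p hp 0 (Nat.zero_le _))
  obtain ⟨p₁, hp₁, he₁⟩ := h3 (hsub (left_mem_Icc.2 hrw))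
  obtain ⟨p₂, hp₂, he₂⟩ := h3 (hsub (right_mem_Icc.2 hrw))
  have hcont : ContinuousOn (fun p => T^[n + 1] p - p) (Icc r w) := h2.sub continuousOn_id
  have hmem : (0 : ℝ) ∈ (fun p => T^[n + 1] p - p) '' Icc r w :=
    (isPreconnected_Icc.image _ hcont).ordConnected.out (mem_image_of_mem _ hp₁)
      (mem_image_of_mem _ hp₂) ⟨by rw [he₁]; linarith [hp₁.1], by rw [he₂]; linarith [hp₂.2]⟩
  obtain ⟨p, hp, he⟩ := hmem
  exact ⟨p, sub_eq_zero.1 he, h1 p hp⟩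

theorem not_mem_both (h : Horseshoe T A B c d) {p : ℝ} (h0 : p ∈ Icc (c false) (d false))
    (h1 : p ∈ Icc (c true) (d true)) : False := disjoint_left.1 h.disjoint h0 h1

theorem exists_minimalPeriod_gt (h : Horseshoe T A B c d) (N : ℕ) :
    ∃ p ∈ Icc (c false) (d false) ∪ Icc (c true) (d true),
      p ∈ Function.periodicPts T ∧ N < Function.minimalPeriod T p := by
  -- The word 0…01 of length N + 1: a period m ≤ N would put the common point T^N p = T^(N-m) p in
  -- both segments.
  obtain ⟨p, hp, hk⟩ := h.exists_fixed N fun k => decide (k = N)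
  have hper : Function.IsPeriodicPt T (N + 1) p := hp
  have hpp : p ∈ Function.periodicPts T := ⟨N + 1, Nat.succ_pos N, hper⟩
  refine ⟨p, ?_, hpp, ?_⟩
  · have h0 := hk 0 (Nat.zero_le _)
    by_cases hN : 0 = N
    · simp only [hN, decide_true] at h0
      exact Or.inr (by simpa [← hN] using h0)
    · simp only [hN, decide_false] at h0
      exact Or.inl h0
  · by_contra hle
    push Not at hle
    have hpos := Function.minimalPeriod_pos_of_mem_periodicPts hpp
    set m := Function.minimalPeriod T p with hm
    have hTm : T^[m] p = p := Function.iterate_minimalPeriod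
    have h1 : T^[N] p = T^[N - m] p := by
      conv_lhs => rw [← Nat.sub_add_cancel hle, Function.iterate_add_apply, hTm]
    have h2 := hk N le_rfl
    have h3 := hk (N - m) (Nat.sub_le _ _)
    have h4 : N - m ≠ N := by omega
    simp only [decide_true] at h2
    simp only [h4, decide_false, ← h1] at h3
    exact h.not_mem_both h3 h2

theorem exists_infinite_periodic (h : Horseshoe T A B c d) :
    ∃ P : Set ℝ, P.Infinite ∧ P ⊆ Icc A B ∧ (∀ p ∈ P, p ∈ Function.periodicPts T) ∧
      ∀ N : ℕ, ∃ p ∈ P, N < Function.minimalPeriod T p := by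
  refine ⟨{p | p ∈ Icc (c false) (d false) ∪ Icc (c true) (d true) ∧ p ∈ Function.periodicPts T},
    fun hfin => ?_, fun p hp => ?_, fun p hp => hp.2, fun N => ?_⟩
  · obtain ⟨N, hN⟩ := (hfin.image (Function.minimalPeriod T)).bddAbove
    obtain ⟨p, hp, hpp, hlt⟩ := h.exists_minimalPeriod_gt N
    exact absurd (hN (mem_image_of_mem _ ⟨hp, hpp⟩)) (not_le.2 hlt)
  · exact hp.1.elim (fun h' => h.subset _ h') fun h' => h.subset _ h'
  · obtain ⟨p, hp, hpp, hlt⟩ := h.exists_minimalPeriod_gt N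
    exact ⟨p, ⟨hp, hpp⟩, hlt⟩

/-- T is continuous only on the segments, so closedness is obtained by peeling off one symbol at a
time. -/
theorem isClosed_itinerary (h : Horseshoe T A B c d) (n : ℕ) (ω : ℕ → Bool) :
    IsClosed {p | ∀ k ≤ n, T^[k] p ∈ Icc (c (ω k)) (d (ω k))} := by
  induction n generalizing ω with
  | zero =>
    simp only [Nat.le_zero, forall_eq, Function.iterate_zero, id]
    exact isClosed_Icc
  | succ n ih =>
    have := (h.continuousOn (ω 0)).preimage_isClosed_of_isClosed isClosed_Icc
      (ih fun k => ω (k + 1))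
    convert this using 1
    ext p
    constructor
    · exact fun hp => ⟨hp 0 (Nat.zero_le _), fun k hk => hp (k + 1) (by omega)⟩
    · rintro ⟨h0, h1⟩ k hk
      cases k with
      | zero => exact h0
      | succ k => exact h1 k (by omega)

theorem exists_itinerary (h : Horseshoe T A B c d) (ω : ℕ → Bool) :
    ∃ p, ∀ k, T^[k] p ∈ Icc (c (ω k)) (d (ω k)) := by
  have hcl := fun n => h.isClosed_itinerary n ω
  have := IsCompact.nonempty_iInter_of_sequence_nonempty_isCompact_isClosed
    (fun n => {p | ∀ k ≤ n, T^[k] p ∈ Icc (c (ω k)) (d (ω k))})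
    (fun n p hp k hk => hp k (hk.trans (Nat.le_succ n)))
    (fun n => (h.exists_fixed n ω).imp fun p hp => hp.2)
    (isCompact_Icc.of_isClosed_subset (hcl 0) fun p hp => hp 0 le_rfl) hcl
  obtain ⟨p, hp⟩ := this
  exact ⟨p, fun k => mem_iInter.1 hp k k le_rfl⟩

theorem continuousOn_union (h : Horseshoe T A B c d) :
    ContinuousOn T (Icc (c false) (d false) ∪ Icc (c true) (d true)) :=
  (h.continuousOn false).union_of_isClosed (h.continuousOn true) isClosed_Icc isClosed_Icc

-- J consists of the points whose whole forward orbit stays in the two segments, and H records the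
-- itinerary. H is continuous because the segments are disjoint and closed, and onto by compactness
-- (`exists_itinerary`).
open Classical in
theorem exists_semiconj (h : Horseshoe T A B c d) :
    ∃ (J : Set ℝ) (H : ℝ → ℕ → Bool), IsCompact J ∧
      J ⊆ Icc (c false) (d false) ∪ Icc (c true) (d true) ∧ T '' J = J ∧ ContinuousOn T J ∧
      ContinuousOn H J ∧ H '' J = univ ∧ ∀ p ∈ J, H (T p) = fun k => H p (k + 1) := by
  set U := Icc (c false) (d false) ∪ Icc (c true) (d true) with hU
  have hUcl : IsClosed U := isClosed_Icc.union isClosed_Icc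
  set J := {p | ∀ n, T^[n] p ∈ U} with hJ
  have hJU : J ⊆ U := fun p hp => hp 0
  have hJT : MapsTo T J J := fun p hp n => hp (n + 1)
  have hJn : ∀ n, IsClosed {p | ∀ k ≤ n, T^[k] p ∈ U} := by
    intro n
    induction n with
    | zero => simpa using hUcl
    | succ n ih =>
      have := h.continuousOn_union.preimage_isClosed_of_isClosed hUcl ih
      convert this using 1
      ext p
      constructor
      · exact fun hp => ⟨hp 0 (Nat.zero_le _), fun k hk => hp (k + 1) (by omega)⟩
      · rintro ⟨h0, h1⟩ k hk
        cases k with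
        | zero => exact h0
        | succ k => exact h1 k (by omega)
  have hJcl : IsClosed J := by
    have : J = ⋂ n, {p | ∀ k ≤ n, T^[k] p ∈ U} := by
      ext p
      simp only [mem_iInter]
      exact ⟨fun hp n k _ => hp k, fun hp n => hp n n le_rfl⟩
    rw [this]
    exact isClosed_iInter hJn
  have hTJ : ContinuousOn T J := h.continuousOn_union.mono hJU
  have hiter : ∀ n, ContinuousOn T^[n] J := by
    intro n
    induction n with
    | zero => exact continuousOn_id
    | succ n ih =>
      rw [Function.iterate_succ]
      exact ih.comp hTJ hJT
  have hdec : ContinuousOn (fun p => decide (p ∈ Icc (c true) (d true))) U := by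
    refine ContinuousOn.union_of_isClosed ?_ ?_ isClosed_Icc isClosed_Icc
    · exact (continuousOn_const (c := false)).congr fun p hp =>
        decide_eq_false fun hp' => h.not_mem_both hp hp'
    · exact (continuousOn_const (c := true)).congr fun p hp => decide_eq_true hp
  refine ⟨J, fun p k => decide (T^[k] p ∈ Icc (c true) (d true)),
    (isCompact_Icc.union isCompact_Icc).of_isClosed_subset hJcl hJU, hJU, ?_, hTJ, ?_, ?_, ?_⟩
  · refine Subset.antisymm hJT.image_subset fun p hp => ?_
    have hpAB : p ∈ Icc A B := (hJU hp).elim (fun h' => h.subset _ h') fun h' => h.subset _ h'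
    -- A preimage chosen in the first segment keeps its whole orbit in `U`.
    obtain ⟨r, hr, rfl⟩ := h.covers false hpAB
    refine ⟨r, fun n => ?_, rfl⟩
    cases n with
    | zero => exact Or.inl hr
    | succ n => exact hp n
  · exact continuousOn_pi.2 fun k => hdec.comp (hiter k) fun p hp => hp k
  · refine eq_univ_of_forall fun ω => ?_
    obtain ⟨p, hp⟩ := h.exists_itinerary ω
    refine ⟨p, fun n => ?_, funext fun k => ?_⟩
    · cases hω : ω n with
      | false => exact Or.inl (hω ▸ hp n)
      | true => exact Or.inr (hω ▸ hp n)
    · cases hω : ω k with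
      | false => exact decide_eq_false fun h1 => h.not_mem_both (hω ▸ hp k) h1
      | true => exact decide_eq_true (hω ▸ hp k)
  · exact fun p _ => rfl

end Horseshoe

/-! ### Estimates for small `b` -/

/-- The parameter `b` is so small that free motions which last about `a / b` and return at a phase
in `[α, 3π/2]` behave as in the limit `b → 0`. -/
structure IsSmall (a b q α : ℝ) : Prop extends Admissible a b q where
  α_pos : 0 < α
  α_lt : α < Real.pi / 2
  small : 1000 * b ≤ a
  -- A return at phase α halts before π + β. Here and below 100 b absorbs the error of the limit
  -- velocity a (1 - cos t).
  halt_before : a * (1 + Real.cos (zeroAngle a b)) + 100 * b < q * (Real.pi + zeroAngle a b - α)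
  -- After a return at phase α the velocity at γ, where F - q turns positive, is still positive.
  slip_through : q * (slipPhase a b q - α) + 100 * b < a * (1 - Real.cos (slipPhase a b q))
  -- A return not later than 3π/2 halts before 7π/4, hence before 2π - β.
  halt_late : a * (1 - Real.cos (7 * Real.pi / 4)) + 100 * b < q * (Real.pi / 4)
  -- Returns at phases in [α, 3π/2] are transversal.
  vel_pos : 100 * b < a * (1 - Real.cos α)
  -- Excludes a contact during the last ten units of time before the return.
  sin_sub_lt : ∀ φ ∈ Icc α (3 * Real.pi / 2), ∀ w ∈ Ioc (0 : ℝ) 10,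
    a * (Real.sin φ - Real.sin (φ - w)) < w * (a - 100 * b)

/-- The free motion from rest at `s` is at the delimiter at time `θ`, after a time of
about `a / b`. -/
structure IsLongFlight (a b s θ : ℝ) : Prop where
  left : Real.pi + zeroAngle a b ≤ s
  right : s ≤ 4 * Real.pi / 3
  -- The window, of width 30 in θ - s, has room for two consecutive periods; its upper end is short
  -- enough that a flight from π + β is not yet back.
  lower : a - 40 * b ≤ b * (θ - s)
  upper : b * (θ - s) ≤ a - 10 * b
  zero : freeDisp a b s θ = 0

/-- The sign of f at a fixed level persists under small changes of the parameter, and strict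
monotonicity keeps the root on the same side of that level. Levels outside the order-connected set
are never crossed. -/
theorem continuousOn_of_strictMonoOn_zero {f : ℝ → ℝ → ℝ} {S I : Set ℝ} {root : ℝ → ℝ}
    (hI : I.OrdConnected) (hr : MapsTo root S I) (h0 : ∀ s ∈ S, f s (root s) = 0)
    (hm : ∀ s ∈ S, StrictMonoOn (f s) I) (hc : ∀ t ∈ I, ContinuousOn (fun s => f s t) S) :
    ContinuousOn root S := by
  intro s hs
  refine tendsto_order.2 ⟨fun t ht => ?_, fun t ht => ?_⟩
  · by_cases htI : t ∈ I
    · have h1 : f s t < 0 := h0 s hs ▸ hm s hs htI (hr hs) ht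
      filter_upwards [(hc t htI s hs).eventually (gt_mem_nhds h1), self_mem_nhdsWithin]
        with u hu huS
      by_contra hle
      have := (hm u huS).monotoneOn (hr huS) htI (not_lt.1 hle)
      rw [h0 u huS] at this
      linarith
    · filter_upwards [self_mem_nhdsWithin] with u huS
      by_contra hle
      exact htI (hI.out (hr huS) (hr hs) ⟨not_lt.1 hle, ht.le⟩)
  · by_cases htI : t ∈ I
    · have h1 : 0 < f s t := h0 s hs ▸ hm s hs (hr hs) htI ht
      filter_upwards [(hc t htI s hs).eventually (lt_mem_nhds h1), self_mem_nhdsWithin]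
        with u hu huS
      by_contra hle
      have := (hm u huS).monotoneOn htI (hr huS) (not_lt.1 hle)
      rw [h0 u huS] at this
      linarith
    · filter_upwards [self_mem_nhdsWithin] with u huS
      by_contra hle
      exact htI (hI.out (hr hs) (hr huS) ⟨ht.le, not_lt.1 hle⟩)

/-- Where the force is negative, a later start raises the displacement at every later time; this
makes return times decrease with the start. -/
theorem hasDerivAt_freeDisp_left (a b s t : ℝ) :
    HasDerivAt (fun s => freeDisp a b s t) (-(t - s) * force a b s) s := by
  have h1 := ((((Real.hasDerivAt_sin s).sub_const (Real.sin t)).add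
    (((hasDerivAt_id s).const_sub t).mul (Real.hasDerivAt_cos s))).const_mul a).add
    ((((hasDerivAt_id s).const_sub t).pow 2).const_mul b)
  refine h1.congr_deriv ?_
  simp [force]
  ring

theorem continuous_freeDisp_left (a b t : ℝ) : Continuous fun s => freeDisp a b s t :=
  continuous_iff_continuousAt.2 fun s => (hasDerivAt_freeDisp_left a b s t).continuousAt

/-- A free motion that starts later, while the force is negative, returns earlier. -/
theorem Admissible.return_lt_return {a b q s s' θ θ' : ℝ} (hA : Admissible a b q)
    (hs : Real.pi + zeroAngle a b ≤ s) (hss : s < s') (hs' : s' < 2 * Real.pi - zeroAngle a b)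
    (hR : IsReturn a b s θ) (hR' : IsReturn a b s' θ') : θ' < θ := by
  have h1 : 2 * Real.pi - zeroAngle a b < θ := by
    by_contra hle
    have := hA.freeDisp_neg (t := θ) 0 (by simpa using hs) hR.1 (by simpa using hle)
    exact this.ne hR.2.1
  have h2 : freeDisp a b s θ < freeDisp a b s' θ :=
    lt_of_hasDerivAt_pos (f := fun s => freeDisp a b s θ) hss
      (continuous_freeDisp_left a b θ).continuousOn
      (fun r _ => hasDerivAt_freeDisp_left a b r θ)
      (fun r hr => by
        have h3 := hA.force_neg (t := r) 0 (by simpa using hs.trans_lt hr.1)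
          (by simpa using hr.2.trans hs')
        have h4 : 0 < θ - r := by linarith [hr.2]
        nlinarith)
  rw [hR.2.1] at h2
  by_contra hle
  rcases (not_lt.1 hle).eq_or_lt with rfl | h3
  · rw [hR'.2.1] at h2
    exact lt_irrefl _ h2
  · exact absurd h2 (not_lt.2 (hR'.2.2 θ ⟨by linarith, h3⟩).le)

namespace IsSmall

variable {a b q α s θ t : ℝ}

theorem zeroAngle_lt (hS : IsSmall a b q α) : zeroAngle a b < Real.pi / 6 := by
  have hz := hS.zeroAngle_mem
  by_contra hle
  push Not at hle
  have h1 := Real.sin_le_sin_of_le_of_le_pi_div_two (by linarith) hz.2.le hle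
  rw [Real.sin_pi_div_six] at h1
  have := mul_le_mul_of_nonneg_left h1 hS.ha.le
  linarith [hS.sin_zeroAngle, hS.small, hS.ha]

/-- Zero displacement reads (θ - s)(a cos s + b (θ - s)) = a (sin θ - sin s); the right side is at
most 2a in size, and θ - s ≥ a/(2b). -/
theorem cos_add_abs_le (hS : IsSmall a b q α) (hL : IsLongFlight a b s θ) :
    |a * Real.cos s + b * (θ - s)| ≤ 4 * b := by
  have ha := hS.ha
  have hb := hS.hb
  have h0 := hL.zero
  unfold freeDisp at h0
  have hLpos : 0 < θ - s := by
    have : 0 < b * (θ - s) := by linarith [hL.lower, hS.small]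
    exact (mul_pos_iff_of_pos_left hb).1 this
  have h1 : (θ - s) * (a * Real.cos s + b * (θ - s)) = a * (Real.sin θ - Real.sin s) := by
    linarith
  have h2 : 2 * a ≤ (θ - s) * (4 * b) := by linarith [hL.lower, hS.small]
  have h3 := Real.sin_le_one θ
  have h4 := Real.neg_one_le_sin θ
  have h5 := Real.sin_le_one s
  have h6 := Real.neg_one_le_sin s
  rw [abs_le]
  constructor
  · refine le_of_mul_le_mul_left ?_ hLpos
    rw [h1]
    nlinarith
  · refine le_of_mul_le_mul_left ?_ hLpos
    rw [h1]
    nlinarith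

/-- The central approximation: near a return the velocity forgets the start. The errors are 4b from
`cos_add_abs_le`, 40b from the window and 40b from |t - θ| ≤ 20. -/
theorem freeVel_abs_le (hS : IsSmall a b q α) (hL : IsLongFlight a b s θ)
    (ht1 : θ - 20 ≤ t) (ht2 : t ≤ θ + 20) :
    |freeVel a b s t - a * (1 - Real.cos t)| ≤ 100 * b := by
  have h1 := abs_le.1 (hS.cos_add_abs_le hL)
  have hb := hS.hb
  have e1 : freeVel a b s t - a * (1 - Real.cos t) = (a * Real.cos s + b * (θ - s)) +
      (b * (θ - s) - a) + 2 * (b * (t - θ)) := by unfold freeVel; ring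
  have h2 : b * (t - θ) ≤ b * 20 := mul_le_mul_of_nonneg_left (by linarith) hb.le
  have h3 : b * (-20) ≤ b * (t - θ) := mul_le_mul_of_nonneg_left (by linarith) hb.le
  rw [e1, abs_le]
  constructor <;> linarith [hL.lower, hL.upper]

/-- Intermediate values in the starting time: at time θ the displacement is non-positive for the
start π + β, where the cosine is nearly -1, and non-negative for the start 4π/3, where it is -1/2.
-/
theorem exists_isLongFlight (hS : IsSmall a b q α) (h1 : a - 35 * b ≤ b * (θ - Real.pi))
    (h2 : b * (θ - Real.pi) ≤ a - 10 * b) : ∃ s, IsLongFlight a b s θ := by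
  have ha := hS.ha
  have hb := hS.hb
  have hz := hS.zeroAngle_mem
  have hz' := hS.zeroAngle_lt
  have hsm := hS.small
  have hpi := Real.pi_lt_d2
  have hpi' := Real.pi_gt_three
  have hrange : ∀ s ∈ Icc (Real.pi + zeroAngle a b) (4 * Real.pi / 3),
      a - 40 * b ≤ b * (θ - s) ∧ b * (θ - s) ≤ a - 10 * b := by
    intro s hs
    have h3 : b * (s - Real.pi) ≤ b * 5 := mul_le_mul_of_nonneg_left (by linarith [hs.2]) hb.le
    have h4 : 0 ≤ b * (s - Real.pi) := mul_nonneg hb.le (by linarith [hs.1])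
    constructor <;> linarith
  have hle : Real.pi + zeroAngle a b ≤ 4 * Real.pi / 3 := by linarith
  have hneg : freeDisp a b (Real.pi + zeroAngle a b) θ ≤ 0 := by
    obtain ⟨h3, h4⟩ := hrange _ (left_mem_Icc.2 hle)
    set s := Real.pi + zeroAngle a b with hs
    have hLpos : 0 < θ - s := (mul_pos_iff_of_pos_left hb).1 (by linarith)
    -- 1 - cos β ≤ sin² β = (2b/a)², which is below b/a.
    have hcos : a - b ≤ a * Real.cos (zeroAngle a b) := by
      have h5 : 0 ≤ Real.cos (zeroAngle a b) :=
        Real.cos_nonneg_of_neg_pi_div_two_le_of_le (by linarith) hz.2.le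
      have h6 := Real.cos_le_one (zeroAngle a b)
      have h7 := Real.sin_sq_add_cos_sq (zeroAngle a b)
      have h8 := hS.sin_zeroAngle
      have h9 : a * (a - a * Real.cos (zeroAngle a b)) ≤ a * b := by
        have : a * (a - a * Real.cos (zeroAngle a b)) ≤ (a * Real.sin (zeroAngle a b)) ^ 2 := by
          have : 0 ≤ a ^ 2 * (Real.cos (zeroAngle a b) * (1 - Real.cos (zeroAngle a b))) :=
            mul_nonneg (sq_nonneg _) (mul_nonneg h5 (by linarith))
          nlinarith
        rw [h8] at this
        nlinarith
      have := le_of_mul_le_mul_left h9 ha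
      linarith
    have h5 := Real.neg_one_le_sin θ
    have h6 : Real.sin s ≤ 0 := by
      rw [hs, add_comm, Real.sin_add_pi]
      have := Real.sin_nonneg_of_nonneg_of_le_pi hz.1.le (by linarith)
      linarith
    have h7 : Real.cos s = -Real.cos (zeroAngle a b) := by rw [hs, add_comm, Real.cos_add_pi]
    have e1 : freeDisp a b s θ = a * (Real.sin s - Real.sin θ) +
        (θ - s) * (b * (θ - s) - a * Real.cos (zeroAngle a b)) := by
      unfold freeDisp; rw [h7]; ring
    have h8 : (θ - s) * (b * (θ - s) - a * Real.cos (zeroAngle a b)) ≤ (θ - s) * (-9 * b) :=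
      mul_le_mul_of_nonneg_left (by linarith) hLpos.le
    have h9 : a * (Real.sin s - Real.sin θ) ≤ a * 1 :=
      mul_le_mul_of_nonneg_left (by linarith) ha.le
    rw [e1]
    linarith
  have hpos : 0 ≤ freeDisp a b (4 * Real.pi / 3) θ := by
    obtain ⟨h3, h4⟩ := hrange _ (right_mem_Icc.2 hle)
    set s := 4 * Real.pi / 3 with hs
    have hLpos : 0 < θ - s := (mul_pos_iff_of_pos_left hb).1 (by linarith)
    have h7 : Real.cos s = -(1 / 2) := by
      rw [hs, show 4 * Real.pi / 3 = Real.pi / 3 + Real.pi by ring, Real.cos_add_pi,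
        Real.cos_pi_div_three]
    have e1 : freeDisp a b s θ = a * (Real.sin s - Real.sin θ) +
        (θ - s) * (b * (θ - s) - a / 2) := by
      unfold freeDisp; rw [h7]; ring
    have h5 := Real.sin_le_one θ
    have h6 := Real.neg_one_le_sin s
    have h8 : (θ - s) * (10 * b) ≤ (θ - s) * (b * (θ - s) - a / 2) :=
      mul_le_mul_of_nonneg_left (by linarith) hLpos.le
    have h9 : a * (-2) ≤ a * (Real.sin s - Real.sin θ) :=
      mul_le_mul_of_nonneg_left (by linarith) ha.le
    rw [e1]
    linarith
  obtain ⟨s, hs, he⟩ := intermediate_value_Icc hle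
    (continuous_freeDisp_left a b θ).continuousOn ⟨hneg, hpos⟩
  exact ⟨s, hs.1, hs.2, (hrange s hs).1, (hrange s hs).2, he⟩

/-- No earlier contact: up to 11π/6 the force is negative; until θ - 10 the term -b (t - s)(θ - t)
dominates the displacement; after that the mean approach speed, nearly a, beats the oscillation by
`sin_sub_lt`. -/
theorem isReturn (hS : IsSmall a b q α) (hL : IsLongFlight a b s θ) (k : ℤ)
    (h1 : α + k * (2 * Real.pi) ≤ θ) (h2 : θ ≤ 3 * Real.pi / 2 + k * (2 * Real.pi)) :
    IsReturn a b s θ := by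
  have ha := hS.ha
  have hb := hS.hb
  have hz := hS.zeroAngle_mem
  have hz' := hS.zeroAngle_lt
  have hsm := hS.small
  have hpi' := Real.pi_gt_three
  have hLpos : 0 < θ - s := (mul_pos_iff_of_pos_left hb).1 (by linarith [hL.lower])
  have hcos := abs_le.1 (hS.cos_add_abs_le hL)
  have hsin : Real.sin s ≤ 0 := by
    rw [← sub_add_cancel s Real.pi, Real.sin_add_pi]
    have := Real.sin_nonneg_of_nonneg_of_le_pi (x := s - Real.pi) (by linarith [hL.left])
      (by linarith [hL.right])
    linarith
  refine ⟨by linarith, hL.zero, fun t ht => ?_⟩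
  rcases le_or_gt t (11 * Real.pi / 6) with h3 | h3
  · exact hS.freeDisp_neg 0 (by simpa using hL.left) ht.1
      (by simp only [Int.cast_zero, zero_mul, add_zero]; linarith)
  rcases le_or_gt t (θ - 10) with h4 | h4
  · have hℓ : 3 / 2 ≤ t - s := by linarith [hL.right]
    -- Bounds (t - s)(θ - t) below by 10 (t - s) + (3/2)(θ - 10 - t); as b (θ - s) is nearly a and
    -- 3/2 > 1, this outweighs the oscillation a.
    have h5 : 0 ≤ b * ((t - s - 3 / 2) * (θ - 10 - t)) :=
      mul_nonneg hb.le (mul_nonneg (by linarith) (by linarith))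
    have h6 : (t - s) * (-(4 * b) - a * Real.cos s - b * (θ - s)) ≤ 0 :=
      mul_nonpos_of_nonneg_of_nonpos (by linarith) (by linarith)
    have h7 := Real.neg_one_le_sin t
    have h8 : a * (Real.sin s - Real.sin t) ≤ a * 1 :=
      mul_le_mul_of_nonneg_left (by linarith) ha.le
    have h9 : 0 ≤ b * (t - s) := mul_nonneg hb.le (by linarith)
    have e1 : freeDisp a b s t = a * (Real.sin s - Real.sin t) + (t - s) * (a * Real.cos s) +
        b * (t - s) ^ 2 := by unfold freeDisp; ring
    rw [e1]
    nlinarith [hL.lower]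
  · have h5 := hS.sin_sub_lt (θ - k * (2 * Real.pi)) ⟨by linarith, by linarith⟩ (θ - t)
      ⟨by linarith [ht.2], by linarith⟩
    rw [show θ - k * (2 * Real.pi) - (θ - t) = t - k * (2 * Real.pi) by ring,
      Real.sin_sub_int_mul_two_pi, Real.sin_sub_int_mul_two_pi] at h5
    have h0 := hL.zero
    have e1 : freeDisp a b s t - freeDisp a b s θ = a * (Real.sin θ - Real.sin t) -
        (θ - t) * (a * Real.cos s + 2 * (b * (θ - s)) - b * (θ - t)) := by
      unfold freeDisp; ring
    have h6 : b * (θ - t) ≤ b * 10 := mul_le_mul_of_nonneg_left (by linarith) hb.le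
    have h7 : (θ - t) * (a - 100 * b) ≤
        (θ - t) * (a * Real.cos s + 2 * (b * (θ - s)) - b * (θ - t)) :=
      mul_le_mul_of_nonneg_left (by linarith [hL.lower]) (by linarith [ht.2])
    linarith

end IsSmall

theorem switchMap_eq_max {a b q s θ u : ℝ} (k : ℤ) (hR : IsReturn a b s θ)
    (hH : IsHalt a b q s θ (u + k * (2 * Real.pi)))
    (hu : u ∈ Ico (-zeroAngle a b) (2 * Real.pi - zeroAngle a b)) :
    switchMap a b q s = max u (Real.pi + zeroAngle a b) :=
  IsNextPhase.switchMap_eq ⟨θ, u, k, hR, hH, hu, rfl⟩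

theorem IsHalt.lt_of_haltVel_neg {a b q s θ σ t : ℝ} (hH : IsHalt a b q s θ σ) (ht : θ ≤ t)
    (hneg : haltVel a b q s θ t < 0) : σ < t := by
  by_contra hle
  rcases (not_lt.1 hle).eq_or_lt with rfl | hlt
  · exact hneg.ne hH.2.1
  · exact absurd hneg (not_lt.2 (hH.2.2 t ⟨ht, hlt⟩).le)

/-! ### Halts and branches of long flights -/

namespace IsSmall

variable {a b q α s θ t : ℝ}

theorem freeVel_pos (hS : IsSmall a b q α) (hL : IsLongFlight a b s θ) (k : ℤ)
    (ht : t ∈ Icc (α + k * (2 * Real.pi)) (3 * Real.pi / 2 + k * (2 * Real.pi)))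
    (ht1 : θ - 20 ≤ t) (ht2 : t ≤ θ + 20) : 0 < freeVel a b s t := by
  have h1 := abs_le.1 (hS.freeVel_abs_le hL ht1 ht2)
  have hα := hS.α_pos
  have hα' := hS.α_lt
  have hcos : Real.cos t ≤ Real.cos α := by
    have h2 : Real.cos (Real.pi - α) ≤ Real.cos |t - k * (2 * Real.pi) - Real.pi| := by
      refine Real.cos_le_cos_of_nonneg_of_le_pi (abs_nonneg _) (by linarith) ?_
      rw [abs_le]
      constructor <;> linarith [ht.1, ht.2]
    rw [Real.cos_abs, Real.cos_sub_pi, Real.cos_sub_int_mul_two_pi, Real.cos_pi_sub] at h2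
    linarith
  have h3 := mul_le_mul_of_nonneg_left hcos hS.ha.le
  linarith [hS.vel_pos]

theorem isLongFlight (hS : IsSmall a b q α) (hR : IsReturn a b s θ)
    (hs : s ∈ Icc (Real.pi + zeroAngle a b) (4 * Real.pi / 3))
    (h1 : a - 35 * b ≤ b * (θ - Real.pi)) (h2 : b * (θ - Real.pi) ≤ a - 10 * b) :
    IsLongFlight a b s θ := by
  have hz := hS.zeroAngle_mem
  have hpi := Real.pi_lt_d2
  have h3 : b * (s - Real.pi) ≤ b * 5 := mul_le_mul_of_nonneg_left (by linarith [hs.2]) hS.hb.le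
  have h4 : 0 ≤ b * (s - Real.pi) := mul_nonneg hS.hb.le (by linarith [hs.1])
  exact ⟨hs.1, hs.2, by linarith, by linarith, hR.2.1⟩

/-- A progression that starts not later than the phase `α` ends before the phase `π + β`. -/
theorem haltVel_neg (hS : IsSmall a b q α) (hL : IsLongFlight a b s θ) (k : ℤ)
    (h1 : θ ≤ α + k * (2 * Real.pi)) (h2 : -4 + k * (2 * Real.pi) ≤ θ) :
    haltVel a b q s θ (Real.pi + zeroAngle a b + k * (2 * Real.pi)) < 0 := by
  have hpi := Real.pi_lt_d2
  have hz := hS.zeroAngle_mem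
  have hα := hS.α_lt
  have h3 := abs_le.1 (hS.freeVel_abs_le hL
    (t := Real.pi + zeroAngle a b + k * (2 * Real.pi)) (by linarith) (by linarith))
  rw [Real.cos_add_int_mul_two_pi, add_comm Real.pi, Real.cos_add_pi] at h3
  have hq : 0 ≤ q := by linarith [hS.hb, hS.hbq]
  have h4 : q * (Real.pi + zeroAngle a b - α) ≤
      q * (zeroAngle a b + Real.pi + k * (2 * Real.pi) - θ) :=
    mul_le_mul_of_nonneg_left (by linarith) hq
  rw [haltVel, add_comm Real.pi]
  linarith [hS.halt_before]

/-- Places the halt where F < q, so that the velocity crosses zero strictly decreasing and the halt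
time depends continuously on the start. -/
theorem exists_isHalt_mem (hS : IsSmall a b q α) (hL : IsLongFlight a b s θ) (k : ℤ)
    (hθ : θ ∈ Icc (α + k * (2 * Real.pi)) (3 * Real.pi / 2 + k * (2 * Real.pi))) :
    ∃ u ∈ Ioo (Real.pi - slipPhase a b q) (7 * Real.pi / 4),
      IsHalt a b q s θ (u + k * (2 * Real.pi)) := by
  have hpi := Real.pi_lt_d2
  have hpi0 := Real.pi_pos
  have hz := hS.zeroAngle_mem
  have hz' := hS.slipPhase_mem
  have hα := hS.α_pos
  have hα' := hS.α_lt
  have hq : 0 ≤ q := by linarith [hS.hb, hS.hbq]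
  obtain ⟨σ, hH⟩ := hS.exists_isHalt (hS.isReturn hL k hθ.1 hθ.2)
  have hlate : haltVel a b q s θ (7 * Real.pi / 4 + k * (2 * Real.pi)) < 0 := by
    have h3 := abs_le.1 (hS.freeVel_abs_le hL (t := 7 * Real.pi / 4 + k * (2 * Real.pi))
      (by linarith [hθ.1, hθ.2]) (by linarith [hθ.1, hθ.2]))
    rw [Real.cos_add_int_mul_two_pi] at h3
    have h4 : q * (Real.pi / 4) ≤ q * (7 * Real.pi / 4 + k * (2 * Real.pi) - θ) :=
      mul_le_mul_of_nonneg_left (by linarith [hθ.2]) hq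
    rw [haltVel]
    linarith [hS.halt_late]
  have hslip : 0 < haltVel a b q s θ (slipPhase a b q + k * (2 * Real.pi)) := by
    have h3 := abs_le.1 (hS.freeVel_abs_le hL (t := slipPhase a b q + k * (2 * Real.pi))
      (by linarith [hθ.1, hθ.2]) (by linarith [hθ.1, hθ.2]))
    rw [Real.cos_add_int_mul_two_pi] at h3
    have h4 : q * (slipPhase a b q + k * (2 * Real.pi) - θ) ≤ q * (slipPhase a b q - α) :=
      mul_le_mul_of_nonneg_left (by linarith [hθ.1]) hq
    rw [haltVel]
    linarith [hS.slip_through]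
  -- F - q passes from negative to positive at γ, so up to π - γ the velocity is at least its value
  -- at γ.
  have hearly : ∀ t, θ ≤ t → t ≤ Real.pi - slipPhase a b q + k * (2 * Real.pi) →
      0 < haltVel a b q s θ t := by
    intro t ht1 ht2
    refine lt_of_lt_of_le hslip ?_
    rcases lt_trichotomy t (slipPhase a b q + k * (2 * Real.pi)) with h | h | h
    · have := lt_of_hasDerivAt_pos (f := fun t => -haltVel a b q s θ t)
        (f' := fun t => -(force a b t - q)) h (continuous_haltVel a b q s θ).neg.continuousOn
        (fun r _ => (hasDerivAt_haltVel a b q s θ r).neg)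
        (fun r hr => by linarith [hS.force_lt' k (t := r) (by linarith [hr.1, hθ.1]) hr.2])
      linarith
    · rw [h]
    · exact (lt_of_hasDerivAt_pos h (continuous_haltVel a b q s θ).continuousOn
        (fun r _ => hasDerivAt_haltVel a b q s θ r)
        (fun r hr => sub_pos.2 (hS.lt_force k hr.1 (hr.2.trans_le ht2)))).le
  refine ⟨σ - k * (2 * Real.pi), ⟨?_, ?_⟩, by rwa [sub_add_cancel]⟩
  · by_contra hle
    push Not at hle
    have := hearly σ hH.1 (by linarith)
    exact this.ne' hH.2.1
  · have := hH.lt_of_haltVel_neg (by linarith [hθ.2]) hlate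
    linarith

/-- A segment of phases whose free motions return within the same period of the force, and whose
image under the switching-phase map contains `[π + β, 3π/2]`. -/
theorem exists_branch (hS : IsSmall a b q α) (k : ℤ)
    (h1 : a - 35 * b ≤ b * (α + k * (2 * Real.pi) - Real.pi))
    (h2 : b * (3 * Real.pi / 2 + k * (2 * Real.pi) - Real.pi) ≤ a - 10 * b) :
    ∃ c d, c < d ∧ Icc c d ⊆ Icc (Real.pi + zeroAngle a b) (4 * Real.pi / 3) ∧
      IsReturn a b c (3 * Real.pi / 2 + k * (2 * Real.pi)) ∧
      IsReturn a b d (α + k * (2 * Real.pi)) ∧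
      ContinuousOn (switchMap a b q) (Icc c d) ∧
      switchMap a b q d = Real.pi + zeroAngle a b ∧ 3 * Real.pi / 2 ≤ switchMap a b q c := by
  have hpi := Real.pi_lt_d2
  have hpi0 := Real.pi_pos
  have hz := hS.zeroAngle_mem
  have hzl := hS.zeroAngle_lt
  have hz' := hS.slipPhase_mem
  have hα := hS.α_pos
  have hα' := hS.α_lt
  have hb := hS.hb
  have hwin : ∀ θ ∈ Icc (α + k * (2 * Real.pi)) (3 * Real.pi / 2 + k * (2 * Real.pi)),
      a - 35 * b ≤ b * (θ - Real.pi) ∧ b * (θ - Real.pi) ≤ a - 10 * b := fun θ hθ =>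
    ⟨h1.trans (mul_le_mul_of_nonneg_left (by linarith [hθ.1]) hb.le),
      (mul_le_mul_of_nonneg_left (by linarith [hθ.2]) hb.le).trans h2⟩
  have hle : α + k * (2 * Real.pi) ≤ 3 * Real.pi / 2 + k * (2 * Real.pi) := by linarith
  have hmemc := right_mem_Icc.2 hle
  have hmemd := left_mem_Icc.2 hle
  obtain ⟨c, hLc⟩ := hS.exists_isLongFlight (hwin _ hmemc).1 (hwin _ hmemc).2
  obtain ⟨d, hLd⟩ := hS.exists_isLongFlight (hwin _ hmemd).1 (hwin _ hmemd).2
  have hRc := hS.isReturn hLc k hmemc.1 hmemc.2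
  have hRd := hS.isReturn hLd k hmemd.1 hmemd.2
  have hcd : c < d := by
    rcases lt_trichotomy c d with h | rfl | h
    · exact h
    · linarith [hRc.unique hRd]
    · linarith [hS.return_lt_return hLd.left h (by linarith [hLc.right]) hRd hRc]
  have hsub : Icc c d ⊆ Icc (Real.pi + zeroAngle a b) (4 * Real.pi / 3) :=
    Icc_subset_Icc hLc.left hLd.right
  have hex : ∀ s ∈ Icc c d, ∃ θ ∈ Icc (α + k * (2 * Real.pi))
      (3 * Real.pi / 2 + k * (2 * Real.pi)), IsReturn a b s θ ∧ IsLongFlight a b s θ := by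
    intro s hs
    have hs' := hsub hs
    obtain ⟨θ, hR⟩ := hS.exists_isReturn (s := s) 0
      (by simp only [Int.cast_zero, zero_mul, add_zero]; exact ⟨hs'.1, by linarith [hs'.2]⟩)
    have hθ : θ ∈ Icc (α + k * (2 * Real.pi)) (3 * Real.pi / 2 + k * (2 * Real.pi)) := by
      constructor
      · rcases hs.2.eq_or_lt with rfl | h
        · exact (hRd.unique hR).le
        · exact (hS.return_lt_return hs'.1 h (by linarith [hLd.right]) hR hRd).le
      · rcases hs.1.eq_or_lt with rfl | h
        · exact (hR.unique hRc).le
        · exact (hS.return_lt_return hLc.left h (by linarith [hs'.2]) hRc hR).le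
    exact ⟨θ, hθ, hR, hS.isLongFlight hR hs' (hwin θ hθ).1 (hwin θ hθ).2⟩
  choose! θ hθ hR hL using hex
  choose! u hu hH using fun s (hs : s ∈ Icc c d) => hS.exists_isHalt_mem (hL s hs) k (hθ s hs)
  have hT : ∀ s ∈ Icc c d, switchMap a b q s = max (u s) (Real.pi + zeroAngle a b) := fun s hs =>
    switchMap_eq_max k (hR s hs) (hH s hs) ⟨by linarith [(hu s hs).1], by linarith [(hu s hs).2]⟩
  have hθc : ContinuousOn θ (Icc c d) := by
    refine continuousOn_of_strictMonoOn_zero (f := freeDisp a b) ordConnected_Icc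
      (fun s hs => hθ s hs) (fun s hs => (hR s hs).2.1) (fun s hs t ht t' ht' htt => ?_)
      (fun t _ => (continuous_freeDisp_left a b t).continuousOn)
    refine lt_of_hasDerivAt_pos htt (continuous_freeDisp a b s).continuousOn
      (fun r _ => hasDerivAt_freeDisp a b s r) (fun r hr => ?_)
    have := hθ s hs
    exact hS.freeVel_pos (hL s hs) k ⟨by linarith [ht.1, hr.1], by linarith [ht'.2, hr.2]⟩
      (by linarith [this.2, ht.1, hr.1]) (by linarith [this.1, ht'.2, hr.2])
  have huc : ContinuousOn u (Icc c d) := by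
    refine continuousOn_of_strictMonoOn_zero
      (f := fun s t => -haltVel a b q s (θ s) (t + k * (2 * Real.pi)))
      (I := Icc (Real.pi - slipPhase a b q) (7 * Real.pi / 4)) ordConnected_Icc
      (fun s hs => Ioo_subset_Icc_self (hu s hs)) (fun s hs => by simp [(hH s hs).2.1])
      (fun s hs t ht t' ht' htt => ?_) (fun t _ => ?_)
    · exact lt_of_hasDerivAt_pos (f := fun t => -haltVel a b q s (θ s) t)
        (f' := fun t => -(force a b t - q)) (by linarith)
        (continuous_haltVel a b q s (θ s)).neg.continuousOn
        (fun r _ => (hasDerivAt_haltVel a b q s (θ s) r).neg)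
        (fun r hr => by
          linarith [hS.force_lt k (t := r) (by linarith [ht.1, hr.1])
            (by linarith [ht'.2, hr.2])])
    · unfold haltVel freeVel
      have := Real.continuous_cos.continuousOn (s := Icc c d)
      fun_prop
  refine ⟨c, d, hcd, hsub, hRc, hRd, ?_, ?_, ?_⟩
  · exact (huc.sup continuousOn_const).congr hT
  · have hd := right_mem_Icc.2 hcd.le
    have hθd := (hR d hd).unique hRd
    have hHd := hH d hd
    rw [hθd] at hHd
    have := hHd.lt_of_haltVel_neg (by linarith) (hS.haltVel_neg hLd k le_rfl (by linarith))
    rw [hT d hd, max_eq_right (by linarith)]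
  · have hc := left_mem_Icc.2 hcd.le
    have hθc := (hR c hc).unique hRc
    have := (hH c hc).1
    rw [hθc] at this
    rw [hT c hc]
    exact le_max_of_le_left (by linarith)

end IsSmall

/-! ### Discontinuity and horseshoe -/

namespace IsSmall

variable {a b q α : ℝ}

/-- The phase of the next transition jumps when the number of periods of the force spent in free
motion changes. -/
theorem not_continuousOn_switchMap (hS : IsSmall a b q α) (k : ℤ) {c d : ℝ}
    (hc : c ∈ Icc (Real.pi + zeroAngle a b) (4 * Real.pi / 3))
    (hd : d ∈ Icc (Real.pi + zeroAngle a b) (4 * Real.pi / 3))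
    (hRc : IsReturn a b c (3 * Real.pi / 2 + k * (2 * Real.pi)))
    (hRd : IsReturn a b d (α + (k + 1 : ℤ) * (2 * Real.pi)))
    (hTc : 3 * Real.pi / 2 ≤ switchMap a b q c)
    (hTd : switchMap a b q d = Real.pi + zeroAngle a b)
    (h1 : a - 35 * b ≤ b * (3 * Real.pi / 2 + k * (2 * Real.pi) - Real.pi))
    (h2 : b * (α + (k + 1 : ℤ) * (2 * Real.pi) - Real.pi) ≤ a - 10 * b) :
    ¬ ContinuousOn (switchMap a b q) (Ico (phase2 a b) (phase3 a b)) := by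
  intro hcont
  have hpi := Real.pi_lt_d2
  have hpi0 := Real.pi_pos
  have hz := hS.zeroAngle_mem
  have hzl := hS.zeroAngle_lt
  have hα := hS.α_pos
  have hα' := hS.α_lt
  have hb := hS.hb
  push_cast at h2 hRd
  have hdc : d < c := by
    rcases lt_trichotomy c d with h | rfl | h
    · linarith [hS.return_lt_return hc.1 h (by linarith [hd.2]) hRc hRd]
    · linarith [hRc.unique hRd]
    · exact h
  have hsub : Icc d c ⊆ Ico (phase2 a b) (phase3 a b) := fun s hs =>
    ⟨hd.1.trans hs.1, (hs.2.trans hc.2).trans_lt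
      (by linarith : 4 * Real.pi / 3 < 2 * Real.pi - zeroAngle a b)⟩
  -- No start between d and c can map to `m`: a halt in period k has phase at least 3π/2 > m, and
  -- one in the next period comes before π + β and yields π + β < m.
  set m := (Real.pi + zeroAngle a b + 3 * Real.pi / 2) / 2 with hm
  obtain ⟨s, hs, he⟩ := intermediate_value_Icc hdc.le (hcont.mono hsub)
    (show m ∈ Icc _ _ from ⟨by rw [hTd]; linarith, by linarith⟩)
  have hs' : s ∈ Icc (Real.pi + zeroAngle a b) (4 * Real.pi / 3) :=
    ⟨hd.1.trans hs.1, hs.2.trans hc.2⟩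
  obtain ⟨θ, hR⟩ := hS.exists_isReturn (s := s) 0
    (by simp only [Int.cast_zero, zero_mul, add_zero]; exact ⟨hs'.1, by linarith [hs'.2]⟩)
  have hθ1 : 3 * Real.pi / 2 + k * (2 * Real.pi) ≤ θ := by
    rcases hs.2.eq_or_lt with rfl | h
    · exact (hRc.unique hR).le
    · exact (hS.return_lt_return hs'.1 h (by linarith [hc.2]) hR hRc).le
  have hθ2 : θ ≤ α + (k + 1) * (2 * Real.pi) := by
    rcases hs.1.eq_or_lt with rfl | h
    · exact (hR.unique hRd).le
    · exact (hS.return_lt_return hd.1 h (by linarith [hs'.2]) hRd hR).le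
  have hL := hS.isLongFlight hR hs'
    (h1.trans (mul_le_mul_of_nonneg_left (by linarith) hb.le))
    ((mul_le_mul_of_nonneg_left (by linarith) hb.le).trans h2)
  obtain ⟨σ, hH⟩ := hS.exists_isHalt hR
  have hσ := hH.lt_of_haltVel_neg (by push_cast; linarith) (hS.haltVel_neg hL (k + 1)
    (by push_cast; linarith) (by push_cast; linarith))
  push_cast at hσ
  have hθσ := hH.1
  rcases lt_or_ge σ (2 * Real.pi - zeroAngle a b + k * (2 * Real.pi)) with h | h
  · have := switchMap_eq_max (u := σ - k * (2 * Real.pi)) k hR (by rwa [sub_add_cancel])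
      ⟨by linarith, by linarith⟩
    have h3 := le_max_left (σ - k * (2 * Real.pi)) (Real.pi + zeroAngle a b)
    rw [← this, he] at h3
    linarith
  · have := switchMap_eq_max (u := σ - (k + 1 : ℤ) * (2 * Real.pi)) (k + 1) hR
      (by rwa [sub_add_cancel]) ⟨by push_cast; linarith, by push_cast; linarith⟩
    rw [max_eq_right (by push_cast; linarith), he] at this
    linarith

/-- For small `b` the switching-phase map has a horseshoe and is discontinuous. -/
theorem exists_horseshoe (hS : IsSmall a b q α) :
    (∃ c d, Horseshoe (switchMap a b q) (phase2 a b) (3 * Real.pi / 2) c d) ∧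
      ¬ ContinuousOn (switchMap a b q) (Ico (phase2 a b) (phase3 a b)) := by
  have hpi := Real.pi_lt_d2
  have hpi0 := Real.pi_gt_three
  have hα := hS.α_pos
  have hα' := hS.α_lt
  have hb := hS.hb
  -- Four periods below a/b, the returns of periods k and k + 1 have θ - π between a/b - 35 and a/b
  -- - 10.
  set k : ℤ := ⌊a / (2 * Real.pi * b)⌋ - 4 with hk
  have hk1 : b * ((k + 4) * (2 * Real.pi)) ≤ a := by
    have := Int.floor_le (a / (2 * Real.pi * b))
    rw [le_div_iff₀ (by positivity)] at this
    rw [hk]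
    push_cast
    linarith
  have hk2 : a < b * ((k + 5) * (2 * Real.pi)) := by
    have := Int.lt_floor_add_one (a / (2 * Real.pi * b))
    rw [div_lt_iff₀ (by positivity)] at this
    rw [hk]
    push_cast
    linarith
  have hbp1 : b * Real.pi < b * 3.15 := mul_lt_mul_of_pos_left hpi hb
  have hbp2 : b * 3 < b * Real.pi := mul_lt_mul_of_pos_left hpi0 hb
  have hbα : 0 < b * α := mul_pos hb hα
  have hbα' : b * α < b * (Real.pi / 2) := mul_lt_mul_of_pos_left hα' hb
  obtain ⟨c₀, d₀, h0, hsub0, hRc0, hRd0, hT0, hTd0, hTc0⟩ :=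
    hS.exists_branch k (by linarith) (by linarith)
  obtain ⟨c₁, d₁, h1, hsub1, hRc1, hRd1, hT1, hTd1, hTc1⟩ :=
    hS.exists_branch (k + 1) (by push_cast; linarith) (by push_cast; linarith)
  have hzl := hS.zeroAngle_lt
  -- Later returns come from earlier starts, so the branch of k + 1 lies to the left.
  have hdc : d₁ < c₀ := by
    have hd := hsub1 (right_mem_Icc.2 h1.le)
    have hc := hsub0 (left_mem_Icc.2 h0.le)
    push_cast at hRd1
    rcases lt_trichotomy c₀ d₁ with h | rfl | h
    · linarith [hS.return_lt_return hc.1 h (by linarith [hd.2]) hRc0 hRd1]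
    · linarith [hRc0.unique hRd1]
    · exact h
  refine ⟨⟨fun i => bif i then c₁ else c₀, fun i => bif i then d₁ else d₀, ?_, ?_, ?_, ?_, ?_⟩, ?_⟩
  · rintro (_ | _)
    exacts [h0, h1]
  · have hle : 4 * Real.pi / 3 ≤ 3 * Real.pi / 2 := by linarith
    rintro (_ | _)
    exacts [hsub0.trans (Icc_subset_Icc_right hle), hsub1.trans (Icc_subset_Icc_right hle)]
  · refine disjoint_left.2 fun t ht ht' => ?_
    have h2 : c₀ ≤ t := ht.1
    have h3 : t ≤ d₁ := ht'.2
    linarith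
  · rintro (_ | _)
    exacts [hT0, hT1]
  · rintro (_ | _)
    · exact (Icc_subset_Icc hTd0.le hTc0).trans (intermediate_value_Icc' h0.le hT0)
    · exact (Icc_subset_Icc hTd1.le hTc1).trans (intermediate_value_Icc' h1.le hT1)
  · exact hS.not_continuousOn_switchMap k (hsub0 (left_mem_Icc.2 h0.le))
      (hsub1 (right_mem_Icc.2 h1.le)) hRc0 hRd1 hTc0 hTd1 (by linarith) (by push_cast; linarith)

end IsSmall

/-! ### Smallness of `b` -/

/-- The difference is w sinc(w/2) cos(φ - w/2). The factor of w is below 1 on a compact rectangle,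
by sinc for w ≠ 0 and by cos φ < 1 for w = 0, so the gap is uniform down to w = 0. -/
theorem exists_mul_sin_sub_lt {α : ℝ} (hα : 0 < α) (hα' : α ≤ 3 * Real.pi / 2) :
    ∃ η > 0, ∀ φ ∈ Icc α (3 * Real.pi / 2), ∀ w ∈ Ioc (0 : ℝ) 10,
      Real.sin φ - Real.sin (φ - w) ≤ w * (1 - η) := by
  have hpi := Real.pi_pos
  have hne : (Icc α (3 * Real.pi / 2) ×ˢ Icc (0 : ℝ) 10).Nonempty :=
    ⟨(α, 0), ⟨le_rfl, hα'⟩, by norm_num, by norm_num⟩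
  have hcont : Continuous fun z : ℝ × ℝ => Real.sinc (z.2 / 2) * Real.cos (z.1 - z.2 / 2) := by
    have := Real.continuous_sinc
    fun_prop
  obtain ⟨z, hz, hmax⟩ := (isCompact_Icc.prod isCompact_Icc).exists_isMaxOn hne hcont.continuousOn
  have hlt : Real.sinc (z.2 / 2) * Real.cos (z.1 - z.2 / 2) < 1 := by
    rcases eq_or_ne z.2 0 with h | h
    · rw [h]
      simp only [zero_div, Real.sinc_zero, sub_zero, one_mul]
      refine (Real.cos_le_one _).lt_of_ne fun h1 => ?_
      have := (Real.cos_eq_one_iff_of_lt_of_lt (by linarith [hz.1.1])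
        (by linarith [hz.1.2])).1 h1
      linarith [hz.1.1]
    · have h1 : |Real.sinc (z.2 / 2)| < 1 := by
        have h2 : z.2 / 2 ≠ 0 := by simpa using h
        rw [Real.sinc_of_ne_zero h2, abs_div, div_lt_one (abs_pos.2 h2)]
        exact Real.abs_sin_lt_abs h2
      have h2 := Real.abs_cos_le_one (z.1 - z.2 / 2)
      refine (le_abs_self _).trans_lt ?_
      rw [abs_mul]
      nlinarith [abs_nonneg (Real.sinc (z.2 / 2)), abs_nonneg (Real.cos (z.1 - z.2 / 2))]
  refine ⟨1 - Real.sinc (z.2 / 2) * Real.cos (z.1 - z.2 / 2), by linarith, fun φ hφ w hw => ?_⟩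
  have h1 := hmax (show (φ, w) ∈ Icc α (3 * Real.pi / 2) ×ˢ Icc (0 : ℝ) 10 from
    ⟨hφ, hw.1.le, hw.2⟩)
  simp only [mem_ofPred_eq] at h1
  have hw0 : w / 2 ≠ 0 := by linarith [hw.1]
  have e1 : Real.sin φ - Real.sin (φ - w) = w * (Real.sinc (w / 2) * Real.cos (φ - w / 2)) := by
    rw [Real.sin_sub_sin, Real.sinc_of_ne_zero hw0]
    have hw1 := hw.1.ne'
    rw [show (φ - (φ - w)) / 2 = w / 2 by ring, show (φ + (φ - w)) / 2 = φ - w / 2 by ring]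
    field_simp
  rw [e1]
  exact mul_le_mul_of_nonneg_left (by linarith) hw.1.le

/-- Half-angle formulas turn the equation for ϑ₀ into (π - x) sin x - cos x = 1 at x = ϑ₀, and the
left side has derivative (π - x) cos x > 0. -/
theorem lt_pi_sub_mul_sin {ϑ₀ ϑ : ℝ} (h0 : ϑ₀ ∈ Icc 0 (Real.pi / 2))
    (hcot : Real.pi - ϑ₀ = Real.cot (ϑ₀ / 2)) (hlt : ϑ₀ < ϑ) (hϑ : ϑ ≤ Real.pi / 2) :
    1 + Real.cos ϑ < (Real.pi - ϑ) * Real.sin ϑ := by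
  have hpi := Real.pi_pos
  have hpos : 0 < ϑ₀ := by
    refine h0.1.lt_of_ne ?_
    rintro rfl
    -- The cotangent at 0 is 0 by division by zero, so ϑ₀ = 0 would give π = 0.
    simp [Real.cot_eq_cos_div_sin] at hcot
  have hsin : 0 < Real.sin (ϑ₀ / 2) := Real.sin_pos_of_pos_of_lt_pi (by linarith)
    (by linarith [h0.2])
  have h1 : (Real.pi - ϑ₀) * Real.sin ϑ₀ - Real.cos ϑ₀ = 1 := by
    have e1 : Real.sin ϑ₀ = 2 * Real.sin (ϑ₀ / 2) * Real.cos (ϑ₀ / 2) := by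
      rw [← Real.sin_two_mul]; congr 1; ring
    have e2 : Real.cos ϑ₀ = 2 * Real.cos (ϑ₀ / 2) ^ 2 - 1 := by
      rw [← Real.cos_two_mul]; congr 1; ring
    rw [hcot, Real.cot_eq_cos_div_sin, e1, e2]
    field_simp
    ring
  have h2 := lt_of_hasDerivAt_pos (f := fun x => (Real.pi - x) * Real.sin x - Real.cos x)
    (f' := fun x => (Real.pi - x) * Real.cos x) hlt (by fun_prop)
    (fun x _ => by
      refine ((((hasDerivAt_id x).const_sub Real.pi).mul (Real.hasDerivAt_sin x)).sub
        (Real.hasDerivAt_cos x)).congr_deriv ?_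
      simp)
    (fun x hx => mul_pos (by linarith [hx.2]) (Real.cos_pos_of_mem_Ioo
      ⟨by linarith [hx.1], by linarith [hx.2]⟩))
  linarith

/-- Says that the lower bound ϑ - (1 - cos ϑ)/sin ϑ for α is positive. -/
theorem one_lt_mul_sin_add_cos {ϑ : ℝ} (h0 : 0 < ϑ) (h1 : ϑ ≤ Real.pi / 2) :
    1 < ϑ * Real.sin ϑ + Real.cos ϑ := by
  have h2 := lt_of_hasDerivAt_pos (f := fun x => x * Real.sin x + Real.cos x)
    (f' := fun x => x * Real.cos x) h0 (by fun_prop)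
    (fun x _ => by
      refine (((hasDerivAt_id x).mul (Real.hasDerivAt_sin x)).add
        (Real.hasDerivAt_cos x)).congr_deriv ?_
      simp)
    (fun x hx => mul_pos hx.1 (Real.cos_pos_of_mem_Ioo ⟨by linarith [hx.1, hx.2],
      by linarith [hx.2]⟩))
  simpa using h2

theorem eventually_isSmall {a q ϑ₀ : ℝ} (h0 : ϑ₀ ∈ Icc 0 (Real.pi / 2))
    (hcot : Real.pi - ϑ₀ = Real.cot (ϑ₀ / 2)) (ha : 0 < a)
    (hq : q ∈ Ioo (a * Real.sin ϑ₀) a) :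
    ∃ α, ∀ᶠ b in 𝓝[>] 0, IsSmall a b q α := by
  have hpi := Real.pi_gt_three
  set ϑ := Real.arcsin (q / a) with hϑ
  have hsin0 : 0 ≤ Real.sin ϑ₀ := Real.sin_nonneg_of_nonneg_of_le_pi h0.1 (by linarith [h0.2])
  have hq0 : 0 < q := (mul_nonneg ha.le hsin0).trans_lt hq.1
  have hqa : q / a < 1 := (div_lt_one ha).2 hq.2
  have hqa0 : 0 < q / a := div_pos hq0 ha
  have hsinϑ : Real.sin ϑ = q / a := Real.sin_arcsin (by linarith) hqa.le
  have hϑ1 : ϑ < Real.pi / 2 := Real.arcsin_lt_pi_div_two.2 hqa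
  have hϑ0 : 0 < ϑ := Real.arcsin_pos.2 hqa0
  have hlt : ϑ₀ < ϑ := by
    by_contra hle
    have h1 := Real.sin_le_sin_of_le_of_le_pi_div_two (by linarith) h0.2 (not_lt.1 hle)
    have h2 := mul_le_mul_of_nonneg_left h1 ha.le
    rw [hsinϑ, mul_div_cancel₀ _ ha.ne'] at h2
    linarith [hq.1]
  have hqe : q = a * Real.sin ϑ := by rw [hsinϑ, mul_div_cancel₀ _ ha.ne']
  have hK := lt_pi_sub_mul_sin h0 hcot hlt hϑ1.le
  have hK' := one_lt_mul_sin_add_cos hϑ0 hϑ1.le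
  set S := Real.sin ϑ with hSdef
  have hS0 : 0 < S := by rw [hsinϑ]; exact hqa0
  have hS1 : S < 1 := by rw [hsinϑ]; exact hqa
  -- The midpoint between the limit bounds of `slip_through` and `halt_before`, which are in the
  -- right order by `hK`.
  set α := ((ϑ - (1 - Real.cos ϑ) / S) + (Real.pi - 2 / S)) / 2 with hα
  have hlo : S * (ϑ - (1 - Real.cos ϑ) / S) = S * ϑ - (1 - Real.cos ϑ) := by field_simp
  have hhi : S * (Real.pi - 2 / S) = S * Real.pi - 2 := by field_simp
  have hαS : S * α = ((S * ϑ - (1 - Real.cos ϑ)) + (S * Real.pi - 2)) / 2 := by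
    rw [← hlo, ← hhi, hα]; ring
  have hα0 : 0 < α := (mul_pos_iff_of_pos_left hS0).1 (by rw [hαS]; linarith)
  have hα2 : S * α < S * Real.pi - 2 := by rw [hαS]; linarith
  have hα3 : S * ϑ - (1 - Real.cos ϑ) < S * α := by rw [hαS]; linarith
  have hαlt : α < Real.pi / 2 := by
    have h1 : S * (Real.pi - α) ≤ 1 * (Real.pi - α) := by
      refine mul_le_mul_of_nonneg_right hS1.le ?_
      by_contra hneg
      have : S * (Real.pi - α) ≤ 0 := mul_nonpos_of_nonneg_of_nonpos hS0.le (by linarith)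
      linarith
    have := Real.pi_lt_d2
    linarith
  obtain ⟨η, hη, hsub⟩ := exists_mul_sin_sub_lt hα0 (by linarith)
  have hcosα : Real.cos α < 1 := by
    refine (Real.cos_le_one _).lt_of_ne fun h1 => ?_
    have := (Real.cos_eq_one_iff_of_lt_of_lt (by linarith) (by linarith)).1 h1
    linarith
  have hcz : Continuous fun b => zeroAngle a b := by
    unfold zeroAngle
    exact Real.continuous_arcsin.comp (by fun_prop)
  have hcs : Continuous fun b => slipPhase a b q := by
    unfold slipPhase
    exact Real.continuous_arcsin.comp (by fun_prop)
  have hz0 : zeroAngle a 0 = 0 := by simp [zeroAngle]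
  have hs0 : slipPhase a 0 q = ϑ := by simp [slipPhase, hϑ]
  have hcos74 : Real.cos (7 * Real.pi / 4) = √2 / 2 := by
    rw [show 7 * Real.pi / 4 = 2 * Real.pi - Real.pi / 4 by ring, Real.cos_two_pi_sub,
      Real.cos_pi_div_four]
  have hev : ∀ {f g : ℝ → ℝ}, Continuous f → Continuous g → f 0 < g 0 →
      ∀ᶠ b in 𝓝[>] 0, f b < g b := fun hf hg h =>
    nhdsWithin_le_nhds (hf.continuousAt.eventually_lt hg.continuousAt h)
  have hcos := Real.continuous_cos
  refine ⟨α, ?_⟩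
  filter_upwards [self_mem_nhdsWithin,
    hev (f := fun b => b) (g := fun _ => a / 2) (by fun_prop) (by fun_prop) (by simpa using ha),
    hev (f := fun b => 2 * b) (g := fun _ => q) (by fun_prop) (by fun_prop) (by simpa using hq0),
    hev (f := fun b => a * (Real.cos (slipPhase a b q) + Real.cos (zeroAngle a b)))
      (g := fun b => (q - 2 * b) * (Real.pi + zeroAngle a b - slipPhase a b q))
      (by fun_prop) (by fun_prop) (by
        simp only [hz0, hs0, Real.cos_zero]
        rw [hqe]
        have := mul_lt_mul_of_pos_left hK ha
        linarith),
    hev (f := fun b => 1000 * b) (g := fun _ => a) (by fun_prop) (by fun_prop) (by simpa using ha),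
    hev (f := fun b => a * (1 + Real.cos (zeroAngle a b)) + 100 * b)
      (g := fun b => q * (Real.pi + zeroAngle a b - α)) (by fun_prop) (by fun_prop) (by
        simp only [hz0, Real.cos_zero]
        rw [hqe]
        have := mul_lt_mul_of_pos_left hα2 ha
        linarith),
    hev (f := fun b => q * (slipPhase a b q - α) + 100 * b)
      (g := fun b => a * (1 - Real.cos (slipPhase a b q))) (by fun_prop) (by fun_prop) (by
        simp only [hs0]
        rw [hqe]
        have := mul_lt_mul_of_pos_left hα3 ha
        linarith),
    hev (f := fun b => a * (1 - Real.cos (7 * Real.pi / 4)) + 100 * b)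
      (g := fun _ => q * (Real.pi / 4)) (by fun_prop) (by fun_prop) (by
        simp only [hcos74]
        rw [hqe]
        have h1 : (1 : ℝ) ≤ √2 := Real.one_le_sqrt.2 (by norm_num)
        -- S π > 2 gives S π / 4 > 1/2 ≥ 1 - √2/2.
        have h2 : 1 - √2 / 2 < S * (Real.pi / 4) := by
          have : 0 < S * α := mul_pos hS0 hα0
          linarith
        have := mul_lt_mul_of_pos_left h2 ha
        linarith),
    hev (f := fun b => 100 * b) (g := fun _ => a * (1 - Real.cos α)) (by fun_prop) (by fun_prop)
      (by simpa using mul_pos ha (by linarith)),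
    hev (f := fun b => 100 * b) (g := fun _ => a * η) (by fun_prop) (by fun_prop)
      (by simpa using mul_pos ha hη)]
    with b hb g1 g2 g3 g4 g5 g6 g7 g8 g9
  exact
  { ha := ha
    hb := hb
    hba := g1
    hbq := g2
    hqa := hq.2
    hslip := g3
    α_pos := hα0
    α_lt := hαlt
    small := g4.le
    halt_before := g5
    slip_through := g6
    halt_late := g7
    vel_pos := g8
    sin_sub_lt := fun φ hφ w hw => by
      have h1 := mul_le_mul_of_nonneg_left (hsub φ hφ w hw) ha.le
      have h2 := mul_lt_mul_of_pos_left g9 hw.1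
      linarith }

theorem theorem1 (ϑ₀ : ℝ) (hϑ₀ : ϑ₀ ∈ Icc 0 (Real.pi / 2))
    (hcot : Real.pi - ϑ₀ = Real.cot (ϑ₀ / 2))
    (a q : ℝ) (ha : 0 < a) (hq : q ∈ Ioo (a * Real.sin ϑ₀) a) :
    ∃ b₀ : ℝ, 0 < b₀ ∧ b₀ ≤ a / 2 ∧ ∀ b : ℝ, 0 < b → b < b₀ →
      ∃ T : ℝ → ℝ, IsSwitchingPhaseMap a b q T ∧
        MapsTo T (Ico (phase2 a b) (phase3 a b)) (Ico (phase2 a b) (phase3 a b)) ∧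
        ¬ ContinuousOn T (Ico (phase2 a b) (phase3 a b)) ∧
        (∃ c₀ d₀ c₁ d₁ : ℝ, c₀ < d₀ ∧ c₁ < d₁ ∧
          Icc c₀ d₀ ⊆ Icc (phase2 a b) (3 * Real.pi / 2) ∧
          Icc c₁ d₁ ⊆ Icc (phase2 a b) (3 * Real.pi / 2) ∧
          Disjoint (Icc c₀ d₀) (Icc c₁ d₁) ∧
          ContinuousOn T (Icc c₀ d₀) ∧ ContinuousOn T (Icc c₁ d₁) ∧
          Icc (phase2 a b) (3 * Real.pi / 2) ⊆ T '' Icc c₀ d₀ ∧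
          Icc (phase2 a b) (3 * Real.pi / 2) ⊆ T '' Icc c₁ d₁ ∧
          ∃ (J : Set ℝ) (H : ℝ → ℕ → Bool), IsCompact J ∧ J ⊆ Icc c₀ d₀ ∪ Icc c₁ d₁ ∧
            T '' J = J ∧ ContinuousOn T J ∧ ContinuousOn H J ∧ H '' J = univ ∧
            ∀ p ∈ J, H (T p) = fun k => H p (k + 1)) ∧
        ∃ P : Set ℝ, P.Infinite ∧ P ⊆ Ico (phase2 a b) (phase3 a b) ∧
          (∀ p ∈ P, p ∈ Function.periodicPts T) ∧
          ∀ N : ℕ, ∃ p ∈ P, N < Function.minimalPeriod T p := by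
  obtain ⟨α, hα⟩ := eventually_isSmall hϑ₀ hcot ha hq
  obtain ⟨w, hw, hsub⟩ := (mem_nhdsGT_iff_exists_Ioo_subset).1 hα
  refine ⟨min w (a / 2), lt_min hw (by linarith), min_le_right _ _, fun b hb hb0 => ?_⟩
  have hS : IsSmall a b q α := hsub ⟨hb, hb0.trans_le (min_le_left _ _)⟩
  have hz := hS.zeroAngle_mem
  obtain ⟨⟨c, d, hH⟩, hdisc⟩ := hS.exists_horseshoe
  refine ⟨switchMap a b q, hS.isSwitchingPhaseMap, fun p hp => hS.switchMap_mem hp, hdisc,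
    ⟨c false, d false, c true, d true, hH.lt _, hH.lt _, hH.subset _, hH.subset _, hH.disjoint,
      hH.continuousOn _, hH.continuousOn _, hH.covers _, hH.covers _, hH.exists_semiconj⟩, ?_⟩
  obtain ⟨P, h1, h2, h3, h4⟩ := hH.exists_infinite_periodic
  exact ⟨P, h1, h2.trans (Icc_subset_Ico_right
    (by linarith : 3 * Real.pi / 2 < 2 * Real.pi - zeroAngle a b)), h3, h4⟩
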